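/- Let $(W,S)$, $S=\{s_i : i\in I\}$, be a simply laced Coxeter system, i.e. its Coxeter matrix satisfies $m_{ij}\in\{2,3\}$ for all $i\ne j$ in $I$ (the set $I$ may be finite or infinite). Let $W$ act on the real vector space $V$ with basis $\{\gamma_i : i\in I\}$ by $s_i v = v-2B(v,\gamma_i)\gamma_i$, where $B$ is the bilinear form with $B(\gamma_i,\gamma_j)=-\cos(\pi/m_{ij})$. Let $\Phi=\{w\gamma_i : w\in W,\ i\in I\}$, let $\Phi^+$ and $\Phi^-$ be the sets of roots whose coefficients in this basis are all nonnegative, respectively all nonpositive, and for $w\in W$ put $\Phi(w)=\{\alpha\in\Phi^+ : w\alpha\in\Phi^-\}$. The height of a root is the sum of its coefficients. The root sequence of a reduced expression $i_1\cdots i_n$ is $(r_1,\dots,r_n)$ with $r_q=s_{i_n}\cdots s_{i_{n-q+2}}(\gamma_{i_{n-q+1}})$. A contractible triple of $w$ is a subset of $\Phi(w)$ of the form $\{\alpha,\beta,\alpha+\beta\}$ whose elements appear consecutively, in some order, in the root sequence of some reduced expression for $w$. The element $w$ is *maximally clustered* if any two intersecting contractible triples of $w$ have the same highest root (root of greatest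 height); *freely braided* if it is maximally clustered and its contractible triples are pairwise disjoint; *fully commutative* if any two reduced expressions for $w$ can be transformed into each other by a sequence of moves that replace two adjacent letters $ij$ with $m_{ij}=2$ by $ji$; and *$iji$-avoiding* if no reduced expression for $w$ contains three consecutive letters $iji$ with $m_{ij}=3$. Then the following are equivalent: (i) $W$ has finitely many maximally clustered elements (that is, $W$ is MC-finite); (ii) $W$ has finitely many freely braided elements; (iii) $W$ has finitely many fully commutative elements. Moreover, an element of $W$ is fully commutative if and only if it is $iji$-avoiding. Finally, $W$ is MC-finite if and only if $S$ is finite and every connected component of the Coxeter graph of $(W,S)$ (the graph on $I$ in which distinct $i,j$ are joined exactly when $m_{ij}=3$) is isomorphic to a subgraph of the graph $E_n$ for some $n\ge 6$, where $E_n$ has vertices $0,1,\dots,n-1$, edges $\{k,k+1\}$ for $1\le k\le n-2$, and the edge $\{0,3\}$. -/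

import Mathlib

/-!
If a component of the Coxeter graph is not contained in any graph `E_n`, then there are arbitrarily
long words in which two occurrences of a letter are always separated by at least two neighbours of
it. Short braid moves preserve this property, so these words are reduced expressions of fully
commutative elements.

Conversely, consider a factor of a reduced expression of a maximally clustered element, with all
letters in a component contained in some `E_n`, and push these letters as far from the branch vertex
as braid moves allow. Two occurrences of a letter other than the branch vertex then enclose its
neighbour on the side of the branch vertex, so the number of occurrences grows by at most one per
step outwards. Between four occurrences of the branch vertex there is one of the first vertex of
the long arm, and then, by induction along that arm, the last vertex occurs at most twice between
two occurrences of the branch vertex. So the number of occurrences of the last vertex is bounded,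
and the pieces between them live on a shorter arm.
-/

noncomputable section


namespace CoxeterMatrix

variable {B : Type*} (M : CoxeterMatrix B)

/-- A Coxeter matrix is simply laced if all its off-diagonal entries are `2` or `3`. -/
def IsSimplyLaced : Prop := ∀ i j : B, i ≠ j → M i j = 2 ∨ M i j = 3

/-- The Coxeter graph of a simply laced Coxeter matrix: distinct vertices `i`, `j` are joined
exactly when `m_{ij} = 3`. -/
def coxeterGraph : SimpleGraph B where
  Adj i j := i ≠ j ∧ M i j = 3
  symm := ⟨fun i j h => ⟨h.1.symm, by rw [M.symmetric]; exact h.2⟩⟩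
  loopless := ⟨fun _ h => h.1 rfl⟩

/-- The simple root `γ_i`, a basis vector of the real vector space `B →₀ ℝ`. -/
def simpleRoot (_M : CoxeterMatrix B) (i : B) : B →₀ ℝ := Finsupp.single i 1

/-- The Coxeter form, the bilinear form with `B(γ_i, γ_j) = - cos (π / m_{ij})`. -/
def coxeterForm : (B →₀ ℝ) →ₗ[ℝ] (B →₀ ℝ) →ₗ[ℝ] ℝ :=
  Finsupp.linearCombination ℝ fun i =>
    Finsupp.linearCombination ℝ fun j => -Real.cos (Real.pi / (M i j : ℝ))

theorem coxeterForm_simpleRoot (i j : B) :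
    M.coxeterForm (M.simpleRoot i) (M.simpleRoot j) = -Real.cos (Real.pi / (M i j : ℝ)) := by
  simp [coxeterForm, simpleRoot]

/-- The reflection `v ↦ v - 2 B(v, γ_i) γ_i`. -/
def simpleReflection (i : B) : Module.End ℝ (B →₀ ℝ) :=
  LinearMap.id - ((2 : ℝ) • M.coxeterForm.flip (M.simpleRoot i)).smulRight (M.simpleRoot i)

theorem simpleReflection_apply (i : B) (v : B →₀ ℝ) :
    M.simpleReflection i v =
      v - (2 * M.coxeterForm v (M.simpleRoot i)) • M.simpleRoot i := by
  simp [simpleReflection]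

variable {M}

/-- The simple reflections satisfy the defining relations of the Coxeter group. -/
theorem IsSimplyLaced.isLiftable (h : M.IsSimplyLaced) :
    M.IsLiftable M.simpleReflection := by
  intro i j
  have hii : ∀ k, M.coxeterForm (M.simpleRoot k) (M.simpleRoot k) = 1 := fun k => by
    rw [coxeterForm_simpleRoot, M.diagonal]; simp
  have hi := hii i
  have hj := hii j
  have hs : M.coxeterForm (M.simpleRoot j) (M.simpleRoot i) =
      M.coxeterForm (M.simpleRoot i) (M.simpleRoot j) := by
    rw [coxeterForm_simpleRoot, coxeterForm_simpleRoot, M.symmetric]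
  by_cases hij : i = j
  · subst hij
    rw [M.diagonal, pow_one]
    refine LinearMap.ext fun v => ?_
    simp only [Module.End.mul_apply, Module.End.one_apply, simpleReflection_apply, map_sub,
      map_smul, hi]
    module
  · have hc := M.coxeterForm_simpleRoot i j
    rcases h i j hij with h2 | h3
    · rw [h2] at hc
      have hc' : M.coxeterForm (M.simpleRoot i) (M.simpleRoot j) = 0 := by
        rw [hc]; simp
      rw [hc'] at hs
      rw [h2, pow_two]
      refine LinearMap.ext fun v => ?_
      simp only [Module.End.mul_apply, Module.End.one_apply, simpleReflection_apply, map_sub,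
        map_smul, LinearMap.sub_apply, LinearMap.smul_apply, hi, hj, hs, hc', smul_eq_mul]
      module
    · rw [h3] at hc
      have hc' : M.coxeterForm (M.simpleRoot i) (M.simpleRoot j) = -(1 / 2) := by
        rw [hc]; simp [Real.cos_pi_div_three]
      rw [hc'] at hs
      rw [h3, pow_succ, pow_two]
      refine LinearMap.ext fun v => ?_
      simp only [Module.End.mul_apply, Module.End.one_apply, simpleReflection_apply, map_sub,
        map_smul, LinearMap.sub_apply, LinearMap.smul_apply, hi, hj, hs, hc', smul_eq_mul]
      module

end CoxeterMatrix

namespace CoxeterSystem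

variable {B W : Type*} [Group W] {M : CoxeterMatrix B} (cs : CoxeterSystem M W)

/-- The reflection representation of a simply laced Coxeter group on `B →₀ ℝ`. -/
def reflectionRep (h : M.IsSimplyLaced) : W →* Module.End ℝ (B →₀ ℝ) :=
  cs.lift ⟨M.simpleReflection, h.isLiftable⟩

variable (h : M.IsSimplyLaced)

/-- The root system `Φ = {w γ_i}`. -/
def roots : Set (B →₀ ℝ) := {v | ∃ (w : W) (i : B), v = cs.reflectionRep h w (M.simpleRoot i)}

/-- The positive roots `Φ⁺`. -/
def posRoots : Set (B →₀ ℝ) := {v | v ∈ cs.roots h ∧ ∀ i, 0 ≤ v i}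

/-- The negative roots `Φ⁻`. -/
def negRoots : Set (B →₀ ℝ) := {v | v ∈ cs.roots h ∧ ∀ i, v i ≤ 0}

/-- The set `Φ(w)` of positive roots sent to negative roots by `w`. -/
def inversionSet (w : W) : Set (B →₀ ℝ) :=
  {v | v ∈ cs.posRoots h ∧ cs.reflectionRep h w v ∈ cs.negRoots h}

/-- The height of a vector: the sum of its coefficients with respect to the simple roots. -/
def height (v : B →₀ ℝ) : ℝ := v.sum fun _ c => c

/-- The root sequence `(r_1, …, r_n)` of a word `i_1 ⋯ i_n`, where
`r_q = s_{i_n} ⋯ s_{i_{n-q+2}} (γ_{i_{n-q+1}})`. The last term is `(s_{i_2} ⋯ s_{i_n})⁻¹ γ_{i_1}`,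
and the earlier terms are the root sequence of `i_2 ⋯ i_n`. -/
def rootSeq : List B → List (B →₀ ℝ)
  | [] => []
  | i :: ω => rootSeq ω ++ [cs.reflectionRep h (cs.wordProd ω)⁻¹ (M.simpleRoot i)]

/-- `ω` is a reduced expression for `w`. -/
def IsReducedExpr (ω : List B) (w : W) : Prop := cs.IsReduced ω ∧ cs.wordProd ω = w

/-- An inversion triple of `w`: a subset of `Φ(w)` of the form `{α, β, α + β}`. -/
def IsInversionTriple (w : W) (T : Set (B →₀ ℝ)) : Prop :=
  T ⊆ cs.inversionSet h w ∧ ∃ α β : B →₀ ℝ, T = {α, β, α + β}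

/-- A contractible triple of `w`: an inversion triple whose elements are consecutive, in some
order, in some root sequence for `w`. -/
def IsContractibleTriple (w : W) (T : Set (B →₀ ℝ)) : Prop :=
  cs.IsInversionTriple h w T ∧
    ∃ ω : List B, cs.IsReducedExpr ω w ∧
      ∃ (l₁ l₂ : List (B →₀ ℝ)) (a b c : B →₀ ℝ),
        cs.rootSeq h ω = l₁ ++ [a, b, c] ++ l₂ ∧ T = {a, b, c}

/-- `γ` is a root of maximal height in `T`. -/
def IsHighestRoot (T : Set (B →₀ ℝ)) (γ : B →₀ ℝ) : Prop :=
  γ ∈ T ∧ ∀ δ ∈ T, height δ ≤ height γ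

/-- `w` is maximally clustered: intersecting contractible triples of `w` have the same
highest root. -/
def IsMaximallyClustered (w : W) : Prop :=
  ∀ T T' : Set (B →₀ ℝ), cs.IsContractibleTriple h w T → cs.IsContractibleTriple h w T' →
    (T ∩ T').Nonempty →
      ∀ γ γ' : B →₀ ℝ, IsHighestRoot T γ → IsHighestRoot T' γ' → γ = γ'

/-- `w` is freely braided: it is maximally clustered and its contractible triples are
pairwise disjoint. -/
def IsFreelyBraided (w : W) : Prop :=
  cs.IsMaximallyClustered h w ∧
    ∀ T T' : Set (B →₀ ℝ), cs.IsContractibleTriple h w T → cs.IsContractibleTriple h w T' →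
      T ≠ T' → Disjoint T T'

/-- A short braid move: replace adjacent letters `i j` with `m_{ij} = 2` by `j i`. -/
def ShortBraidMove (M : CoxeterMatrix B) (ω ω' : List B) : Prop :=
  ∃ (u v : List B) (i j : B), M i j = 2 ∧ ω = u ++ [i, j] ++ v ∧ ω' = u ++ [j, i] ++ v

/-- Two words are short braid equivalent if one is obtained from the other by a finite sequence
of short braid moves. -/
def ShortBraidEquiv (M : CoxeterMatrix B) (ω ω' : List B) : Prop :=
  Relation.ReflTransGen (ShortBraidMove M) ω ω'

/-- `w` is fully commutative: all its reduced expressions are short braid equivalent. -/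
def IsFullyCommutative (w : W) : Prop :=
  ∀ ω ω' : List B, cs.IsReducedExpr ω w → cs.IsReducedExpr ω' w → ShortBraidEquiv M ω ω'

/-- `w` is `iji`-avoiding: no reduced expression for `w` has a factor `i j i` of consecutive
letters with `m_{ij} = 3`. -/
def IsIjiAvoiding (w : W) : Prop :=
  ∀ ω : List B, cs.IsReducedExpr ω w →
    ¬ ∃ (u v : List B) (i j : B), M i j = 3 ∧ ω = u ++ [i, j, i] ++ v

end CoxeterSystem

/-- The Coxeter graph of type `E_n` (meant for `n ≥ 6`): vertices `0, 1, …, n - 1`, with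
`1 - 2 - 3 - ⋯ - (n - 1)` a path and `0` joined to `3`. -/
def coxeterGraphE (n : ℕ) : SimpleGraph (Fin n) :=
  SimpleGraph.fromRel fun i j : Fin n =>
    (1 ≤ (i : ℕ) ∧ (i : ℕ) + 1 = (j : ℕ)) ∨ ((i : ℕ) = 0 ∧ (j : ℕ) = 3)

end

namespace SimplyLacedCoxeter

open CoxeterSystem

/-! ### Descents and signs of roots -/

section Roots

variable {B W : Type*} [Group W] {M : CoxeterMatrix B}

theorem ne_of_eq_three {i j : B} (hij : M i j = 3) : i ≠ j := by
  rintro rfl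
  rw [M.diagonal] at hij
  omega

variable (cs : CoxeterSystem M W)

theorem simple_mul_simple_comm {i j : B} (hij : M i j = 2) :
    cs.simple i * cs.simple j = cs.simple j * cs.simple i := by
  have hpow := cs.simple_mul_simple_pow i j
  rw [hij, pow_two] at hpow
  simpa using eq_inv_of_mul_eq_one_left hpow

theorem simple_mul_simple_mul_simple {i j : B} (hij : M i j = 3) :
    cs.simple i * cs.simple j * cs.simple i = cs.simple j * cs.simple i * cs.simple j := by
  have hpow := cs.simple_mul_simple_pow i j
  rw [hij, pow_succ, pow_two] at hpow
  have hmul : (cs.simple i * cs.simple j * cs.simple i) *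
      (cs.simple j * cs.simple i * cs.simple j) = 1 := by
    simpa only [mul_assoc] using hpow
  simpa [mul_assoc] using eq_inv_of_mul_eq_one_left hmul

theorem not_isRightDescent_mul_of_eq_two {w : W} {i j : B} (hij : M i j = 2)
    (hi : cs.IsRightDescent w i) (hj : ¬cs.IsRightDescent w j) :
    ¬cs.IsRightDescent (w * cs.simple i) j := by
  intro hd
  rw [isRightDescent_iff] at hi hd
  rw [not_isRightDescent_iff] at hj
  have hw : w * cs.simple j = w * cs.simple i * cs.simple j * cs.simple i := by
    simp [mul_assoc, simple_mul_simple_comm cs ((M.symmetric j i).trans hij)]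
  have hle := cs.length_mul_le (w * cs.simple i * cs.simple j) (cs.simple i)
  rw [← hw, length_simple] at hle
  omega

theorem not_isRightDescent_mul_mul_of_eq_three {w : W} {i j : B} (hij : M i j = 3)
    (hi : cs.IsRightDescent w i) (hj : ¬cs.IsRightDescent w j)
    (hji : cs.IsRightDescent (w * cs.simple i) j) :
    ¬cs.IsRightDescent (w * cs.simple i * cs.simple j) i := by
  intro hd
  rw [isRightDescent_iff] at hi hji hd
  rw [not_isRightDescent_iff] at hj
  have hw : w * cs.simple j =
      w * cs.simple i * cs.simple j * cs.simple i * (cs.simple j * cs.simple i) := by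
    have := simple_mul_simple_mul_simple cs hij
    calc w * cs.simple j
        = w * (cs.simple j * cs.simple i * cs.simple j) * (cs.simple j * cs.simple i) := by
          simp [mul_assoc]
      _ = _ := by rw [← this]; simp only [mul_assoc]
  have hle := cs.length_mul_le (w * cs.simple i * cs.simple j * cs.simple i)
    (cs.simple j * cs.simple i)
  have hle' := cs.length_mul_le (cs.simple j) (cs.simple i)
  rw [← hw] at hle
  rw [length_simple, length_simple] at hle'
  omega

variable (h : M.IsSimplyLaced)

theorem reflectionRep_mul_apply (w w' : W) (v : B →₀ ℝ) :
    cs.reflectionRep h (w * w') v = cs.reflectionRep h w (cs.reflectionRep h w' v) := by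
  rw [map_mul, Module.End.mul_apply]

theorem reflectionRep_inv_apply_self (w : W) (v : B →₀ ℝ) :
    cs.reflectionRep h w⁻¹ (cs.reflectionRep h w v) = v := by
  rw [← reflectionRep_mul_apply, inv_mul_cancel, map_one, Module.End.one_apply]

theorem reflectionRep_injective (w : W) : Function.Injective (cs.reflectionRep h w) :=
  Function.LeftInverse.injective (reflectionRep_inv_apply_self cs h w)

theorem reflectionRep_eq_mul_simple_apply (w : W) (i : B) (v : B →₀ ℝ) :
    cs.reflectionRep h w v =
      cs.reflectionRep h (w * cs.simple i) (cs.reflectionRep h (cs.simple i) v) := by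
  rw [← reflectionRep_mul_apply, mul_assoc, simple_mul_simple_self, mul_one]

theorem simple_apply_simpleRoot (i j : B) :
    cs.reflectionRep h (cs.simple i) (M.simpleRoot j) =
      M.simpleRoot j + (2 * Real.cos (Real.pi / M j i)) • M.simpleRoot i := by
  have hi : cs.reflectionRep h (cs.simple i) = M.simpleReflection i :=
    cs.lift_apply_simple h.isLiftable i
  rw [hi, CoxeterMatrix.simpleReflection_apply, CoxeterMatrix.coxeterForm_simpleRoot]
  module

theorem simple_apply_self (i : B) :
    cs.reflectionRep h (cs.simple i) (M.simpleRoot i) = -M.simpleRoot i := by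
  rw [simple_apply_simpleRoot, M.diagonal]
  simp only [Nat.cast_one, div_one, Real.cos_pi]
  module

theorem simple_apply_of_eq_two {i j : B} (hij : M i j = 2) :
    cs.reflectionRep h (cs.simple i) (M.simpleRoot j) = M.simpleRoot j := by
  rw [simple_apply_simpleRoot, M.symmetric, hij]
  simp

theorem simple_apply_of_eq_three {i j : B} (hij : M i j = 3) :
    cs.reflectionRep h (cs.simple i) (M.simpleRoot j) = M.simpleRoot j + M.simpleRoot i := by
  rw [simple_apply_simpleRoot, M.symmetric, hij]
  norm_num [Real.cos_pi_div_three]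

theorem simpleRoot_nonneg (M : CoxeterMatrix B) (i : B) : 0 ≤ M.simpleRoot i :=
  Finsupp.single_nonneg.2 zero_le_one

theorem reflectionRep_nonneg_of_not_isRightDescent {w : W} {i : B}
    (hi : ¬cs.IsRightDescent w i) : 0 ≤ cs.reflectionRep h w (M.simpleRoot i) := by
  induction hn : cs.length w using Nat.strong_induction_on generalizing w i with
  | _ n ih =>
  subst hn
  by_cases hw : w = 1
  · rw [hw, map_one, Module.End.one_apply]
    exact simpleRoot_nonneg M i
  obtain ⟨j, hj⟩ := cs.exists_rightDescent_of_ne_one hw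
  have hji : j ≠ i := by rintro rfl; exact hi hj
  have hlt : cs.length (w * cs.simple j) < cs.length w := hj
  have hjj : ¬cs.IsRightDescent (w * cs.simple j) j :=
    cs.isRightDescent_iff_not_isRightDescent_mul.1 hj
  rw [reflectionRep_eq_mul_simple_apply cs h w j]
  rcases h j i hji with hm | hm
  · rw [simple_apply_of_eq_two cs h hm]
    exact ih _ hlt (not_isRightDescent_mul_of_eq_two cs hm hj hi) rfl
  rw [simple_apply_of_eq_three cs h hm]
  by_cases hd : cs.IsRightDescent (w * cs.simple j) i
  · have hroot : cs.reflectionRep h (cs.simple i) (M.simpleRoot i + M.simpleRoot j) =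
        M.simpleRoot j := by
      rw [map_add, simple_apply_self, simple_apply_of_eq_three cs h (M.symmetric i j ▸ hm)]
      abel
    rw [reflectionRep_eq_mul_simple_apply cs h _ i, hroot]
    exact ih _ (lt_trans hd hlt) (not_isRightDescent_mul_mul_of_eq_three cs hm hj hi hd) rfl
  · rw [map_add]
    exact add_nonneg (ih _ hlt hd rfl) (ih _ hlt hjj rfl)

theorem isRightDescent_iff_reflectionRep_nonpos {w : W} {i : B} :
    cs.IsRightDescent w i ↔ cs.reflectionRep h w (M.simpleRoot i) ≤ 0 := by
  refine ⟨fun hi => ?_, fun hneg => ?_⟩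
  · rw [reflectionRep_eq_mul_simple_apply cs h w i, simple_apply_self, map_neg, neg_nonpos]
    exact reflectionRep_nonneg_of_not_isRightDescent cs h
      (cs.isRightDescent_iff_not_isRightDescent_mul.1 hi)
  · by_contra hi
    have hzero := le_antisymm hneg (reflectionRep_nonneg_of_not_isRightDescent cs h hi)
    have hi0 : M.simpleRoot i = 0 := reflectionRep_injective cs h w (by rw [hzero, map_zero])
    simp [CoxeterMatrix.simpleRoot] at hi0

theorem isLeftDescent_iff_reflectionRep_nonpos {w : W} {i : B} :
    cs.IsLeftDescent w i ↔ cs.reflectionRep h w⁻¹ (M.simpleRoot i) ≤ 0 := by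
  rw [← isRightDescent_inv_iff, isRightDescent_iff_reflectionRep_nonpos cs h]

include h in
theorem isLeftDescent_mul_of_eq_two {w : W} {i j : B} (hij : M i j = 2)
    (hj : cs.IsLeftDescent w j) : cs.IsLeftDescent (cs.simple i * w) j := by
  rw [isLeftDescent_iff_reflectionRep_nonpos cs h] at hj ⊢
  rwa [mul_inv_rev, inv_simple, reflectionRep_mul_apply, simple_apply_of_eq_two cs h hij]

include h in
theorem isLeftDescent_mul_of_eq_three {w : W} {i j : B} (hij : M i j = 3)
    (hi : cs.IsLeftDescent w i) (hj : cs.IsLeftDescent w j) :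
    cs.IsLeftDescent (cs.simple i * w) j := by
  rw [isLeftDescent_iff_reflectionRep_nonpos cs h] at hi hj ⊢
  rw [mul_inv_rev, inv_simple, reflectionRep_mul_apply, simple_apply_of_eq_three cs h hij, map_add]
  exact add_nonpos hj hi

include h in
theorem isLeftDescent_mul_mul_of_eq_three {w : W} {i j : B} (hij : M i j = 3)
    (hj : cs.IsLeftDescent w j) : cs.IsLeftDescent (cs.simple j * (cs.simple i * w)) i := by
  rw [isLeftDescent_iff_reflectionRep_nonpos cs h] at hj ⊢
  rw [mul_inv_rev, mul_inv_rev, inv_simple, inv_simple, reflectionRep_mul_apply,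
    reflectionRep_mul_apply, simple_apply_of_eq_three cs h (M.symmetric i j ▸ hij), map_add,
    simple_apply_self, simple_apply_of_eq_three cs h hij]
  simpa using hj

end Roots

/-! ### Short braid equivalence and stable words -/

section StableWords

variable {B W : Type*} [Group W] {M : CoxeterMatrix B}

theorem shortBraidEquiv_symm {ω ω' : List B} (he : ShortBraidEquiv M ω ω') :
    ShortBraidEquiv M ω' ω := by
  have : Std.Symm (ShortBraidMove M) := ⟨by
    rintro _ _ ⟨u, v, i, j, hij, rfl, rfl⟩
    exact ⟨u, v, j, i, M.symmetric i j ▸ hij, rfl, rfl⟩⟩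
  exact Relation.ReflTransGen.stdSymm.symm _ _ he

theorem perm_of_shortBraidEquiv {ω ω' : List B} (he : ShortBraidEquiv M ω ω') : ω.Perm ω' := by
  induction he with
  | refl => exact .refl _
  | tail _ hmove ih =>
    obtain ⟨u, v, i, j, -, rfl, rfl⟩ := hmove
    exact ih.trans (((List.Perm.swap j i []).append_left u).append_right v)

theorem shortBraidEquiv_cons {ω ω' : List B} (i : B) (he : ShortBraidEquiv M ω ω') :
    ShortBraidEquiv M (i :: ω) (i :: ω') := by
  refine Relation.ReflTransGen.lift (i :: ·) ?_ _ _ he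
  rintro _ _ ⟨u, v, j, k, hjk, rfl, rfl⟩
  exact ⟨i :: u, v, j, k, hjk, rfl, rfl⟩

/-- A word is stable if no word short braid equivalent to it has a factor `i i`, or a factor
`i j i` with `m_{ij} = 3`. These turn out to be the reduced words of the fully commutative
elements, but stability does not mention the group. -/
def IsStable (M : CoxeterMatrix B) (ω : List B) : Prop :=
  ∀ ω', ShortBraidEquiv M ω ω' →
    (∀ u v i, ω' ≠ u ++ [i, i] ++ v) ∧ ∀ u v i j, M i j = 3 → ω' ≠ u ++ [i, j, i] ++ v

theorem IsStable.of_shortBraidEquiv {ω ω' : List B} (hs : IsStable M ω)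
    (he : ShortBraidEquiv M ω ω') : IsStable M ω' := fun _ he' => hs _ (he.trans he')

theorem IsStable.tail {i : B} {ω : List B} (hs : IsStable M (i :: ω)) : IsStable M ω := by
  intro ω' he
  obtain ⟨hpair, htriple⟩ := hs _ (shortBraidEquiv_cons i he)
  exact ⟨fun u v j hj => hpair (i :: u) v j (by simp [hj]),
    fun u v j k hjk hj => htriple (i :: u) v j k hjk (by simp [hj])⟩

variable (cs : CoxeterSystem M W)

theorem wordProd_eq_of_shortBraidEquiv {ω ω' : List B} (he : ShortBraidEquiv M ω ω') :
    cs.wordProd ω = cs.wordProd ω' := by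
  induction he with
  | refl => rfl
  | tail _ hmove ih =>
    obtain ⟨u, v, j, k, hjk, rfl, rfl⟩ := hmove
    rw [ih]
    simp only [wordProd_append, wordProd_cons, wordProd_nil, mul_one,
      simple_mul_simple_comm cs hjk]

theorem isReduced_of_append_left {u v : List B} (hω : cs.IsReduced (u ++ v)) :
    cs.IsReduced u := by
  simpa using hω.take u.length

theorem isReduced_of_append_right {u v : List B} (hω : cs.IsReduced (u ++ v)) :
    cs.IsReduced v := by
  simpa using hω.drop u.length

theorem isReducedExpr_cons_iff {i : B} {ω : List B} {w : W} :
    cs.IsReducedExpr (i :: ω) w ↔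
      cs.IsLeftDescent w i ∧ cs.IsReducedExpr ω (cs.simple i * w) := by
  rw [isLeftDescent_iff]
  constructor
  · rintro ⟨hred, rfl⟩
    have htail : cs.IsReduced ω := isReduced_of_append_right cs (u := [i]) hred
    rw [hred.eq, wordProd_cons, simple_mul_simple_cancel_left, htail.eq]
    exact ⟨rfl, htail, rfl⟩
  · rintro ⟨hd, hred, hprod⟩
    have hw : cs.wordProd (i :: ω) = w := by simp [wordProd_cons, hprod]
    refine ⟨?_, hw⟩
    rw [CoxeterSystem.IsReduced, hw, List.length_cons, ← hred.eq, hprod, hd]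

theorem isReduced_cons_iff {i : B} {ω : List B} (hω : cs.IsReduced ω) :
    cs.IsReduced (i :: ω) ↔ ¬cs.IsLeftDescent (cs.wordProd ω) i := by
  rw [not_isLeftDescent_iff, CoxeterSystem.IsReduced, wordProd_cons, hω.eq, List.length_cons]

theorem exists_isReducedExpr (w : W) : ∃ ω, cs.IsReducedExpr ω w := by
  obtain ⟨ω, hred, rfl⟩ := cs.exists_isReduced w
  exact ⟨ω, hred, rfl⟩

theorem exists_isReducedExpr_pair (h : M.IsSimplyLaced) {w : W} {i j : B} (hij : M i j = 2)
    (hi : cs.IsLeftDescent w i) (hj : cs.IsLeftDescent w j) :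
    ∃ τ, cs.IsReducedExpr (i :: j :: τ) w := by
  obtain ⟨τ, hτ⟩ := exists_isReducedExpr cs (cs.simple j * (cs.simple i * w))
  refine ⟨τ, ?_⟩
  simp only [isReducedExpr_cons_iff]
  exact ⟨hi, isLeftDescent_mul_of_eq_two cs h hij hj, hτ⟩

theorem exists_isReducedExpr_triple (h : M.IsSimplyLaced) {w : W} {i j : B} (hij : M i j = 3)
    (hi : cs.IsLeftDescent w i) (hj : cs.IsLeftDescent w j) :
    ∃ τ, cs.IsReducedExpr (i :: j :: i :: τ) w := by
  obtain ⟨τ, hτ⟩ :=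
    exists_isReducedExpr cs (cs.simple i * (cs.simple j * (cs.simple i * w)))
  refine ⟨τ, ?_⟩
  simp only [isReducedExpr_cons_iff]
  exact ⟨hi, isLeftDescent_mul_of_eq_three cs h hij hi hj,
    isLeftDescent_mul_mul_of_eq_three cs h hij hj, hτ⟩

theorem isReducedExpr_nil_iff {ω : List B} : cs.IsReducedExpr ω 1 ↔ ω = [] := by
  refine ⟨fun hω => ?_, fun hω => by simp [hω, IsReducedExpr, CoxeterSystem.IsReduced]⟩
  rw [← List.length_eq_zero_iff, ← hω.1.eq, hω.2, length_one]

theorem shortBraidEquiv_cons_of_isReducedExpr {i : B} {ω τ : List B}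
    (hω : ∀ ω', cs.IsReducedExpr ω' (cs.wordProd ω) → ShortBraidEquiv M ω ω')
    (hτ : cs.IsReducedExpr (i :: τ) (cs.wordProd (i :: ω))) :
    ShortBraidEquiv M (i :: ω) (i :: τ) := by
  rw [isReducedExpr_cons_iff, wordProd_cons, simple_mul_simple_cancel_left] at hτ
  exact shortBraidEquiv_cons i (hω τ hτ.2)

theorem IsStable.isReduced_cons {i : B} {ω : List B} (hs : IsStable M (i :: ω))
    (hred : cs.IsReduced ω)
    (hω : ∀ ω', cs.IsReducedExpr ω' (cs.wordProd ω) → ShortBraidEquiv M ω ω') :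
    cs.IsReduced (i :: ω) := by
  rw [isReduced_cons_iff cs hred]
  intro hd
  obtain ⟨τ, hτ⟩ := exists_isReducedExpr cs (cs.simple i * cs.wordProd ω)
  have hequiv : ShortBraidEquiv M ω (i :: τ) := hω _ ((isReducedExpr_cons_iff cs).2 ⟨hd, hτ⟩)
  exact (hs _ (shortBraidEquiv_cons i hequiv)).1 [] τ i rfl

theorem IsStable.isReduced_and_shortBraidEquiv (h : M.IsSimplyLaced) {ω : List B}
    (hs : IsStable M ω) :
    cs.IsReduced ω ∧
      ∀ ω', cs.IsReducedExpr ω' (cs.wordProd ω) → ShortBraidEquiv M ω ω' := by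
  induction hn : ω.length generalizing ω with
  | zero =>
    rw [List.length_eq_zero_iff] at hn
    subst hn
    refine ⟨by simp [CoxeterSystem.IsReduced], fun ω' hω' => ?_⟩
    rw [wordProd_nil, isReducedExpr_nil_iff] at hω'
    rw [hω']
    exact .refl
  | succ n ih =>
  obtain ⟨i, ω, rfl⟩ := List.exists_cons_of_length_eq_add_one hn
  rw [List.length_cons, Nat.add_right_cancel_iff] at hn
  obtain ⟨hred, hequiv⟩ := ih hs.tail hn
  have hred_cons := hs.isReduced_cons cs hred hequiv
  refine ⟨hred_cons, fun ω' hω' => ?_⟩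
  have hlen : ω'.length = n + 1 := by rw [← hω'.1.eq, hω'.2, hred_cons.eq, List.length_cons, hn]
  obtain ⟨j, ω', rfl⟩ := List.exists_cons_of_length_eq_add_one hlen
  have hi := ((isReducedExpr_cons_iff cs).1 (⟨hred_cons, rfl⟩ : cs.IsReducedExpr (i :: ω) _)).1
  have hj := (isReducedExpr_cons_iff cs).1 hω'
  by_cases hij : i = j
  · subst hij
    exact shortBraidEquiv_cons_of_isReducedExpr cs hequiv hω'
  rcases h i j hij with hm | hm
  · obtain ⟨τ, hτ⟩ := exists_isReducedExpr_pair cs h hm hi hj.1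
    have hswap : ShortBraidEquiv M (i :: ω) (j :: i :: τ) :=
      (shortBraidEquiv_cons_of_isReducedExpr cs hequiv hτ).tail ⟨[], τ, i, j, hm, rfl, rfl⟩
    have hlenτ : (i :: τ).length = n := by
      have := (perm_of_shortBraidEquiv hswap).length_eq
      simp only [List.length_cons] at this ⊢
      omega
    refine hswap.trans
      (shortBraidEquiv_cons j ((ih (hs.of_shortBraidEquiv hswap).tail hlenτ).2 ω' ?_))
    have := hj.2
    rwa [wordProd_eq_of_shortBraidEquiv cs hswap, wordProd_cons,
      simple_mul_simple_cancel_left] at this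
  · obtain ⟨τ, hτ⟩ := exists_isReducedExpr_triple cs h hm hi hj.1
    exact absurd rfl ((hs _ (shortBraidEquiv_cons_of_isReducedExpr cs hequiv hτ)).2 [] τ i j hm)

theorem IsStable.isFullyCommutative (h : M.IsSimplyLaced) {ω : List B} (hs : IsStable M ω) :
    cs.IsFullyCommutative (cs.wordProd ω) := by
  intro ω₁ ω₂ h₁ h₂
  have hequiv := (hs.isReduced_and_shortBraidEquiv cs h).2
  exact (shortBraidEquiv_symm (hequiv _ h₁)).trans (hequiv _ h₂)

theorem isReducedExpr_of_eq_three {u v : List B} {i j : B} (hij : M i j = 3) {w : W}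
    (hr : cs.IsReducedExpr (u ++ [i, j, i] ++ v) w) :
    cs.IsReducedExpr (u ++ [j, i, j] ++ v) w := by
  have hbraid : cs.wordProd [i, j, i] = cs.wordProd [j, i, j] := by
    simpa [wordProd_cons, mul_assoc] using simple_mul_simple_mul_simple cs hij
  have hprod : cs.wordProd (u ++ [i, j, i] ++ v) = cs.wordProd (u ++ [j, i, j] ++ v) := by
    simp only [wordProd_append, hbraid]
  refine ⟨?_, hprod ▸ hr.2⟩
  rw [CoxeterSystem.IsReduced, ← hprod, hr.1.eq]
  simp only [List.length_append, List.length_cons]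

theorem not_isReduced_of_pair (u v : List B) (i : B) : ¬cs.IsReduced (u ++ [i, i] ++ v) := by
  intro hr
  have hpair : cs.IsReduced [i, i] :=
    isReduced_of_append_right cs (isReduced_of_append_left cs hr)
  simpa [wordProd_cons] using hpair.eq

theorem isFullyCommutative_iff_isIjiAvoiding (h : M.IsSimplyLaced) (w : W) :
    cs.IsFullyCommutative w ↔ cs.IsIjiAvoiding w := by
  constructor
  · rintro hfc _ hω ⟨u, v, i, j, hij, rfl⟩
    classical
    have hperm := perm_of_shortBraidEquiv (hfc _ _ hω (isReducedExpr_of_eq_three cs hij hω))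
    simpa [(ne_of_eq_three hij).symm] using hperm.count_eq i
  · intro havoid
    obtain ⟨ω, hω, rfl⟩ := cs.exists_isReduced w
    refine IsStable.isFullyCommutative cs h fun ω' he => ?_
    have hprod := wordProd_eq_of_shortBraidEquiv cs he
    have hω' : cs.IsReduced ω' := by
      rw [CoxeterSystem.IsReduced, ← hprod, hω.eq, (perm_of_shortBraidEquiv he).length_eq]
    refine ⟨?_, fun u v i j hij hi => havoid _ ⟨hω', hprod.symm⟩ ⟨u, v, i, j, hij, hi⟩⟩
    rintro u v i rfl
    exact not_isReduced_of_pair cs u v i hω'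

end StableWords

/-! ### Root sequences and contractible triples -/

section RootSequences

variable {B W : Type*} [Group W] {M : CoxeterMatrix B} (cs : CoxeterSystem M W)
variable (h : M.IsSimplyLaced)

/-- The entry `s_{i_n} ⋯ s_{i_{k+1}} γ_{i_k}` of a root sequence, as a function of the letter
`i = i_k` and of the word `v = i_{k+1} ⋯ i_n` to its right. -/
noncomputable def letterRoot (i : B) (v : List B) : B →₀ ℝ :=
  cs.reflectionRep h (cs.wordProd v)⁻¹ (M.simpleRoot i)

theorem letterRoot_append (i : B) (x v : List B) :
    letterRoot cs h i (x ++ v) = cs.reflectionRep h (cs.wordProd v)⁻¹ (letterRoot cs h i x) := by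
  rw [letterRoot, letterRoot, wordProd_append, mul_inv_rev, reflectionRep_mul_apply]

theorem letterRoot_cons (i j : B) (v : List B) :
    letterRoot cs h i (j :: v) =
      cs.reflectionRep h (cs.wordProd v)⁻¹ (cs.reflectionRep h (cs.simple j) (M.simpleRoot i)) := by
  rw [letterRoot, wordProd_cons, mul_inv_rev, inv_simple, reflectionRep_mul_apply]

theorem letterRoot_cons_self (i : B) (v : List B) :
    letterRoot cs h i (i :: v) = -letterRoot cs h i v := by
  rw [letterRoot_cons, simple_apply_self, map_neg, letterRoot]

theorem letterRoot_cons_of_eq_two {i j : B} (hij : M i j = 2) (v : List B) :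
    letterRoot cs h i (j :: v) = letterRoot cs h i v := by
  rw [letterRoot_cons, simple_apply_of_eq_two cs h ((M.symmetric j i).trans hij), letterRoot]

theorem letterRoot_cons_of_eq_three {i j : B} (hij : M i j = 3) (v : List B) :
    letterRoot cs h i (j :: v) = letterRoot cs h i v + letterRoot cs h j v := by
  rw [letterRoot_cons, simple_apply_of_eq_three cs h ((M.symmetric j i).trans hij), map_add,
    letterRoot, letterRoot]

theorem letterRoot_cons_cons_of_eq_three {i j : B} (hij : M i j = 3) (v : List B) :
    letterRoot cs h i (j :: i :: v) = letterRoot cs h j v := by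
  rw [letterRoot_cons_of_eq_three cs h hij, letterRoot_cons_self,
    letterRoot_cons_of_eq_three cs h ((M.symmetric j i).trans hij)]
  abel

theorem letterRoot_nonneg {i : B} {v : List B} (hv : cs.IsReduced (i :: v)) :
    0 ≤ letterRoot cs h i v := by
  apply reflectionRep_nonneg_of_not_isRightDescent
  rw [isRightDescent_inv_iff]
  exact (isReduced_cons_iff cs (isReduced_of_append_right cs (u := [i]) hv)).1 hv

theorem letterRoot_mem_inversionSet {u v : List B} {i : B} {w : W}
    (hr : cs.IsReducedExpr (u ++ i :: v) w) : letterRoot cs h i v ∈ cs.inversionSet h w := by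
  obtain ⟨hr, rfl⟩ := hr
  have hui : cs.IsReduced (u ++ [i]) :=
    isReduced_of_append_left cs (v := v) (by simpa using hr)
  refine ⟨⟨⟨_, i, rfl⟩, letterRoot_nonneg cs h (isReduced_of_append_right cs hr)⟩,
    ⟨_, i, (reflectionRep_mul_apply cs h _ _ _).symm⟩, fun k => ?_⟩
  rw [wordProd_append, wordProd_cons, reflectionRep_mul_apply, reflectionRep_mul_apply,
    letterRoot, ← reflectionRep_mul_apply cs h (cs.wordProd v), mul_inv_cancel, map_one,
    Module.End.one_apply, simple_apply_self, map_neg, Finsupp.neg_apply, neg_nonpos]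
  refine reflectionRep_nonneg_of_not_isRightDescent cs h ?_ k
  rw [not_isRightDescent_iff, (isReduced_of_append_left cs hui).eq, ← wordProd_singleton cs i,
    ← wordProd_append, hui.eq, List.length_append, List.length_singleton]

theorem letterRoot_append_cons_ne {i : B} {x : List B} (hx : cs.IsReduced (i :: x)) (j : B)
    (v : List B) : letterRoot cs h i (x ++ j :: v) ≠ letterRoot cs h j v := by
  intro he
  have hneg : letterRoot cs h i x = -M.simpleRoot j := by
    rw [letterRoot_append, ← neg_neg (letterRoot cs h j v), ← letterRoot_cons_self,
      letterRoot.eq_1 cs h j, ← map_neg] at he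
    exact reflectionRep_injective cs h _ he
  have hj := letterRoot_nonneg cs h hx j
  rw [hneg] at hj
  norm_num [CoxeterMatrix.simpleRoot] at hj

theorem rootSeq_append (u v : List B) :
    cs.rootSeq h (u ++ v) =
      cs.rootSeq h v ++ (cs.rootSeq h u).map (cs.reflectionRep h (cs.wordProd v)⁻¹) := by
  induction u with
  | nil => simp [rootSeq]
  | cons i u ih =>
    rw [List.cons_append, rootSeq, ih, rootSeq, List.map_append, List.append_assoc,
      List.map_singleton, wordProd_append, mul_inv_rev, reflectionRep_mul_apply]

theorem length_rootSeq (u : List B) : (cs.rootSeq h u).length = u.length := by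
  induction u with
  | nil => rfl
  | cons i u ih => simp [rootSeq, ih]

theorem rootSeq_triple_append (i j k : B) (v : List B) :
    cs.rootSeq h ([i, j, k] ++ v) = cs.rootSeq h v ++
      [letterRoot cs h k v, letterRoot cs h j (k :: v), letterRoot cs h i (j :: k :: v)] := by
  simp [rootSeq, letterRoot]

theorem height_add (v v' : B →₀ ℝ) : height (v + v') = height v + height v' :=
  Finsupp.sum_add_index' (fun _ => rfl) (fun _ _ _ => rfl)

theorem height_nonneg {v : B →₀ ℝ} (hv : 0 ≤ v) : 0 ≤ height v :=
  Finset.sum_nonneg fun i _ => hv i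

theorem isHighestRoot_add {α β : B →₀ ℝ} (hα : 0 ≤ α) (hβ : 0 ≤ β) :
    IsHighestRoot {α, β, α + β} (α + β) := by
  have hα' := height_nonneg hα
  have hβ' := height_nonneg hβ
  refine ⟨by simp, ?_⟩
  rintro x (rfl | rfl | rfl) <;> rw [height_add] <;> linarith

/-- The triple of roots of a factor `i j i`, `m_{ij} = 3`, followed by the word `v`. -/
noncomputable def braidTriple (i j : B) (v : List B) : Set (B →₀ ℝ) :=
  {letterRoot cs h i v, letterRoot cs h j v, letterRoot cs h i v + letterRoot cs h j v}

section BraidTriple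

variable {u v : List B} {i j : B} {w : W}

theorem letterRoots_mem_inversionSet (hij : M i j = 3)
    (hr : cs.IsReducedExpr (u ++ [i, j, i] ++ v) w) :
    letterRoot cs h i v ∈ cs.inversionSet h w ∧ letterRoot cs h j v ∈ cs.inversionSet h w ∧
      letterRoot cs h i v + letterRoot cs h j v ∈ cs.inversionSet h w := by
  have hfst := letterRoot_mem_inversionSet cs h (u := u ++ [i, j]) (i := i) (v := v)
    (by simpa using hr)
  have hsnd := letterRoot_mem_inversionSet cs h (u := u ++ [i]) (i := j) (v := i :: v)
    (by simpa using hr)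
  have htrd := letterRoot_mem_inversionSet cs h (u := u) (i := i) (v := j :: i :: v)
    (by simpa using hr)
  rw [letterRoot_cons_of_eq_three cs h ((M.symmetric j i).trans hij), add_comm] at hsnd
  rw [letterRoot_cons_cons_of_eq_three cs h hij] at htrd
  exact ⟨hfst, htrd, hsnd⟩

theorem isContractibleTriple_braidTriple (hij : M i j = 3)
    (hr : cs.IsReducedExpr (u ++ [i, j, i] ++ v) w) :
    cs.IsContractibleTriple h w (braidTriple cs h i j v) := by
  obtain ⟨hi, hj, hadd⟩ := letterRoots_mem_inversionSet cs h hij hr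
  refine ⟨⟨?_, _, _, rfl⟩, _, hr, cs.rootSeq h v,
    (cs.rootSeq h u).map (cs.reflectionRep h (cs.wordProd ([i, j, i] ++ v))⁻¹),
    letterRoot cs h i v, letterRoot cs h i v + letterRoot cs h j v, letterRoot cs h j v, ?_, ?_⟩
  · rintro x (rfl | rfl | rfl) <;> assumption
  · rw [List.append_assoc, rootSeq_append, rootSeq_triple_append,
      letterRoot_cons_of_eq_three cs h ((M.symmetric j i).trans hij),
      letterRoot_cons_cons_of_eq_three cs h hij, add_comm (letterRoot cs h j v)]
  · rw [braidTriple, Set.pair_comm]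

theorem isHighestRoot_braidTriple (hij : M i j = 3)
    (hr : cs.IsReducedExpr (u ++ [i, j, i] ++ v) w) :
    IsHighestRoot (braidTriple cs h i j v) (letterRoot cs h i v + letterRoot cs h j v) := by
  obtain ⟨hi, hj, -⟩ := letterRoots_mem_inversionSet cs h hij hr
  exact isHighestRoot_add hi.1.2 hj.1.2

end BraidTriple

theorem exists_append_triple_of_rootSeq_eq {ω : List B} {l₁ l₂ : List (B →₀ ℝ)} {a b c : B →₀ ℝ}
    (hω : cs.rootSeq h ω = l₁ ++ [a, b, c] ++ l₂) :
    ∃ u i j k v, ω = u ++ [i, j, k] ++ v ∧ a = letterRoot cs h k v ∧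
      b = letterRoot cs h j (k :: v) ∧ c = letterRoot cs h i (j :: k :: v) := by
  have hlen := congrArg List.length hω
  simp only [length_rootSeq, List.length_append, List.length_cons, List.length_nil] at hlen
  obtain ⟨u, x, v, rfl, hx, hv⟩ : ∃ u x v : List B, ω = u ++ x ++ v ∧ x.length = 3 ∧
      v.length = l₁.length := by
    refine ⟨ω.take l₂.length, (ω.drop l₂.length).take 3, (ω.drop l₂.length).drop 3, ?_, ?_, ?_⟩
    · rw [List.append_assoc, List.take_append_drop, List.take_append_drop]
    · rw [List.length_take, List.length_drop]; omega
    · rw [List.length_drop, List.length_drop]; omega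
  obtain ⟨i, j, k, rfl⟩ := List.length_eq_three.1 hx
  rw [List.append_assoc, rootSeq_append, rootSeq_triple_append, List.append_assoc,
    List.append_assoc] at hω
  have htail := List.append_inj_right hω (by rw [length_rootSeq, hv])
  have htriple := List.append_inj_left htail rfl
  simp only [List.cons.injEq, and_true] at htriple
  exact ⟨u, i, j, k, v, rfl, htriple.1.symm, htriple.2.1.symm, htriple.2.2.symm⟩

theorem eq_and_eq_three_of_simpleRoot_relation {i j k : B} (hij : i ≠ j)
    (hs : -M.simpleRoot k = M.simpleRoot j + cs.reflectionRep h (cs.simple j) (M.simpleRoot i) ∨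
      M.simpleRoot j = -M.simpleRoot k + cs.reflectionRep h (cs.simple j) (M.simpleRoot i) ∨
      cs.reflectionRep h (cs.simple j) (M.simpleRoot i) = -M.simpleRoot k + M.simpleRoot j) :
    i = k ∧ M i j = 3 := by
  have hone (l : B) : M.simpleRoot l l = 1 := by simp [CoxeterMatrix.simpleRoot]
  have hzero {l m : B} (hlm : l ≠ m) : M.simpleRoot l m = 0 := by
    simp [CoxeterMatrix.simpleRoot, hlm]
  have hcoeff : cs.reflectionRep h (cs.simple j) (M.simpleRoot i) i = 1 := by
    rw [simple_apply_simpleRoot, Finsupp.add_apply, Finsupp.smul_apply, hone, hzero hij.symm,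
      smul_zero, add_zero]
  have hik : i = k := by
    by_contra hik
    rcases hs with hs | hs | hs <;> have := DFunLike.congr_fun hs i <;>
      simp [hcoeff, hzero hij.symm, hzero (Ne.symm hik)] at this
  subst hik
  refine ⟨rfl, (h i j hij).resolve_left fun htwo => ?_⟩
  rw [simple_apply_of_eq_two cs h ((M.symmetric j i).trans htwo)] at hs
  rcases hs with hs | hs | hs
  · have := DFunLike.congr_fun hs j
    simp [hone, hzero hij] at this
  · have := DFunLike.congr_fun hs j
    simp [hone] at this
  · have := DFunLike.congr_fun hs j
    simp [hone, hzero hij] at this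

theorem eq_add_of_triple_eq {V : Type*} [AddCommGroup V] {a b c α β : V} (hab : a ≠ b)
    (hac : a ≠ c) (hbc : b ≠ c) (he : ({a, b, c} : Set V) = {α, β, α + β}) :
    a = b + c ∨ b = a + c ∨ c = a + b := by
  have hα : α ∈ ({a, b, c} : Set V) := he ▸ by simp
  have hβ : β ∈ ({a, b, c} : Set V) := he ▸ by simp
  have hs : α + β ∈ ({a, b, c} : Set V) := he ▸ by simp
  have ha : a ∈ ({α, β, α + β} : Set V) := he ▸ by simp
  have hb : b ∈ ({α, β, α + β} : Set V) := he ▸ by simp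
  have hc : c ∈ ({α, β, α + β} : Set V) := he ▸ by simp
  simp only [Set.mem_insert_iff, Set.mem_singleton_iff] at hα hβ hs ha hb hc
  grind

theorem exists_factor_of_isContractibleTriple {w : W} {T : Set (B →₀ ℝ)}
    (hT : cs.IsContractibleTriple h w T) :
    ∃ u v i j, M i j = 3 ∧ cs.IsReducedExpr (u ++ [i, j, i] ++ v) w := by
  obtain ⟨⟨-, α, β, hαβ⟩, ω, hω, l₁, l₂, a, b, c, hl, rfl⟩ := hT
  obtain ⟨u, i, j, k, v, rfl, rfl, rfl, rfl⟩ := exists_append_triple_of_rootSeq_eq cs h hl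
  have hr : cs.IsReduced [i, j, k] :=
    isReduced_of_append_right cs (isReduced_of_append_left cs hω.1)
  have hij : i ≠ j := by
    rintro rfl
    exact not_isReduced_of_pair cs [] [k] i (by simpa using hr)
  have hrij : cs.IsReduced [i, j] := isReduced_of_append_left cs (v := [k]) hr
  have hrj : cs.IsReduced [j] := isReduced_of_append_right cs (u := [i]) hrij
  have hsum := eq_add_of_triple_eq
    (letterRoot_append_cons_ne cs h (x := []) hrj k v).symm
    (letterRoot_append_cons_ne cs h (x := [j]) hrij k v).symm
    (letterRoot_append_cons_ne cs h (x := []) (isReduced_of_append_left cs (v := [j]) hrij) j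
      (k :: v)).symm hαβ
  -- The first root is `-letterRoot k (k :: v)`, so all three are images under `(k v)⁻¹`.
  rw [← neg_neg (letterRoot cs h k v), ← letterRoot_cons_self, List.nil_append,
    List.singleton_append, letterRoot_cons cs h i j, letterRoot, letterRoot, ← map_neg] at hsum
  simp only [← map_add, (reflectionRep_injective cs h _).eq_iff] at hsum
  obtain ⟨rfl, hthree⟩ := eq_and_eq_three_of_simpleRoot_relation cs h hij hsum
  exact ⟨u, v, i, j, hthree, hω⟩

theorem isFreelyBraided_of_isIjiAvoiding {w : W} (hw : cs.IsIjiAvoiding w) :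
    cs.IsFreelyBraided h w := by
  have hno (T) : ¬cs.IsContractibleTriple h w T := fun hT => by
    obtain ⟨u, v, i, j, hij, hω⟩ := exists_factor_of_isContractibleTriple cs h hT
    exact hw _ hω ⟨u, v, i, j, hij, rfl⟩
  exact ⟨fun T _ hT => (hno T hT).elim, fun T _ hT => (hno T hT).elim⟩

end RootSequences

/-! ### A firing game on graphs -/

section FiringGame

variable {V : Type*} (G : SimpleGraph V)

open Classical in
/-- The state after firing the vertex `i`. A state records how often the neighbours of each vertex
have fired since its own last firing, so firing `i` resets the counter of `i` and increments the
counters of the neighbours of `i`. -/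
noncomputable def fire (i : V) (σ : V → ℕ) : V → ℕ :=
  fun j => if j = i then 0 else if G.Adj i j then σ j + 1 else σ j

/-- The word `ω` lists, from left to right, legal firings from the state `σ`: a vertex may fire
when its counter is at least `2`. Started from the constant state `2`, legal sequences are words in
which two occurrences of a letter are separated by at least two of its neighbours. -/
def IsLegalFiring : (V → ℕ) → List V → Prop
  | _, [] => True
  | σ, i :: ω => 2 ≤ σ i ∧ IsLegalFiring (fire G i σ) ω

/-- From the constant state `2` one can fire forever. This is encoded by a set of states that
contains the constant state `2` and in which a legal firing is always possible. -/
def HasInfinitePlay : Prop :=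
  ∃ S : Set (V → ℕ), (fun _ => 2) ∈ S ∧ ∀ σ ∈ S, ∃ i, 2 ≤ σ i ∧ fire G i σ ∈ S

variable {G}

theorem fire_self (i : V) (σ : V → ℕ) : fire G i σ i = 0 := by simp [fire]

theorem fire_of_adj {i j : V} (hij : G.Adj i j) (σ : V → ℕ) : fire G i σ j = σ j + 1 := by
  simp [fire, hij, hij.ne']

theorem fire_of_not_adj {i j : V} (hne : j ≠ i) (hij : ¬G.Adj i j) (σ : V → ℕ) :
    fire G i σ j = σ j := by
  simp [fire, hij, hne]

theorem le_fire {i j : V} (hne : j ≠ i) (σ : V → ℕ) : σ j ≤ fire G i σ j := by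
  by_cases hij : G.Adj i j
  · rw [fire_of_adj hij]; omega
  · rw [fire_of_not_adj hne hij]

theorem fire_comm {i j : V} (hne : i ≠ j) (hij : ¬G.Adj i j) (σ : V → ℕ) :
    fire G i (fire G j σ) = fire G j (fire G i σ) := by
  have hji : ¬G.Adj j i := fun hji => hij hji.symm
  funext k
  rcases eq_or_ne k i with rfl | hki
  · rw [fire_self, fire_of_not_adj hne hji, fire_self]
  rcases eq_or_ne k j with rfl | hkj
  · rw [fire_self, fire_of_not_adj hne.symm hij, fire_self]
  simp only [fire, hki, hkj, if_false]
  split_ifs <;> rfl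

theorem IsLegalFiring.exists_state {σ : V → ℕ} {u v : List V} (hω : IsLegalFiring G σ (u ++ v)) :
    ∃ τ, IsLegalFiring G τ v ∧ ∀ v', IsLegalFiring G τ v' → IsLegalFiring G σ (u ++ v') := by
  induction u generalizing σ with
  | nil => exact ⟨σ, hω, fun _ hv' => hv'⟩
  | cons i u ih =>
    obtain ⟨τ, hv, hτ⟩ := ih hω.2
    exact ⟨τ, hv, fun v' hv' => ⟨hω.1, hτ v' hv'⟩⟩

theorem HasInfinitePlay.exists_isLegalFiring (hG : HasInfinitePlay G) (n : ℕ) :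
    ∃ ω : List V, ω.length = n ∧ IsLegalFiring G (fun _ => 2) ω := by
  obtain ⟨S, hstart, hS⟩ := hG
  suffices ∀ σ ∈ S, ∃ ω : List V, ω.length = n ∧ IsLegalFiring G σ ω from this _ hstart
  induction n with
  | zero => exact fun σ _ => ⟨[], rfl, trivial⟩
  | succ n ih =>
    intro σ hσ
    obtain ⟨i, hi, hσ'⟩ := hS σ hσ
    obtain ⟨ω, hlen, hω⟩ := ih _ hσ'
    exact ⟨i :: ω, by rw [List.length_cons, hlen], hi, hω⟩

theorem HasInfinitePlay.of_isContained {V' : Type*} {H : SimpleGraph V'} (hG : HasInfinitePlay G)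
    (hGH : G.IsContained H) : HasInfinitePlay H := by
  obtain ⟨S, hstart, hS⟩ := hG
  obtain ⟨f⟩ := hGH
  refine ⟨{σ | ∃ τ ∈ S, ∀ v, τ v ≤ σ (f v)}, ⟨_, hstart, fun _ => le_rfl⟩, ?_⟩
  rintro σ ⟨τ, hτ, hle⟩
  obtain ⟨i, hi, hτ'⟩ := hS τ hτ
  refine ⟨f i, hi.trans (hle i), _, hτ', fun v => ?_⟩
  rcases eq_or_ne v i with rfl | hvi
  · rw [fire_self]
    exact Nat.zero_le _
  by_cases hiv : G.Adj i v
  · have hadj : H.Adj (f i) (f v) := f.toHom.map_adj hiv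
    rw [fire_of_adj hiv, fire_of_adj hadj]
    exact Nat.succ_le_succ (hle v)
  · rw [fire_of_not_adj hvi hiv]
    exact (hle v).trans (le_fire (f.injective.ne hvi) σ)

/-! ### Graphs with infinite plays -/

-- `x` is the cyclic sequence of fired vertices and `st` bounds the states below; the graph on
-- `Fin n` has the edge list `E`.
theorem hasInfinitePlay_of_table {n N : ℕ} [NeZero N] (E : List (Fin n × Fin n))
    (x : Fin N → Fin n) (st : Fin N → Fin n → ℕ) (hstart : ∀ v, st 0 v ≤ 2)
    (hlegal : ∀ r, 2 ≤ st r (x r))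
    (hstep : ∀ r v, st (r + 1) v ≤
      if v = x r then 0 else if (x r, v) ∈ E ∨ (v, x r) ∈ E then st r v + 1 else st r v)
    {f : Fin n → V} (hf : Function.Injective f) (hE : ∀ e ∈ E, G.Adj (f e.1) (f e.2)) :
    HasInfinitePlay G := by
  refine ⟨{σ | ∃ r, ∀ v, st r v ≤ σ (f v)}, ⟨0, hstart⟩, ?_⟩
  rintro σ ⟨r, hr⟩
  refine ⟨f (x r), (hlegal r).trans (hr _), r + 1, fun v => (hstep r v).trans ?_⟩
  split_ifs with hv hadj
  · exact Nat.zero_le _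
  · rw [fire_of_adj (hadj.elim (hE _) fun hvx => (hE _ hvx).symm)]
    exact Nat.succ_le_succ (hr v)
  · exact (hr v).trans (le_fire (hf.ne hv) σ)

theorem hasInfinitePlay_of_arms_two {b x₁ x₂ x₃ y₁ y₂ y₃ : V}
    (hn : [b, x₁, x₂, x₃, y₁, y₂, y₃].Nodup)
    (hx₁ : G.Adj b x₁) (hx₂ : G.Adj b x₂) (hx₃ : G.Adj b x₃)
    (hy₁ : G.Adj x₁ y₁) (hy₂ : G.Adj x₂ y₂) (hy₃ : G.Adj x₃ y₃) : HasInfinitePlay G := by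
  refine hasInfinitePlay_of_table (n := 7) (N := 12)
    [(0, 1), (0, 2), (0, 3), (1, 4), (2, 5), (3, 6)]
    ![4, 1, 0, 2, 5, 6, 3, 0, 1, 2, 0, 3]
    ![![1, 1, 1, 0, 2, 1, 2], ![1, 2, 1, 0, 0, 1, 2], ![2, 0, 1, 0, 1, 1, 2],
      ![0, 1, 2, 1, 1, 1, 2], ![1, 1, 0, 1, 1, 2, 2], ![1, 1, 1, 1, 1, 0, 2],
      ![1, 1, 1, 2, 1, 0, 0], ![2, 1, 1, 0, 1, 0, 1], ![0, 2, 2, 1, 1, 0, 1],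
      ![1, 0, 2, 1, 2, 0, 1], ![2, 0, 0, 1, 2, 1, 1], ![0, 1, 1, 2, 2, 1, 1]]
    (by decide) (by decide) (by decide)
    (List.nodup_iff_injective_get.1 hn) ?_
  simp [hx₁, hx₂, hx₃, hy₁, hy₂, hy₃]

theorem hasInfinitePlay_of_arms_one_three_three {b q x₁ x₂ y₁ y₂ z₁ z₂ : V}
    (hn : [b, q, x₁, x₂, y₁, y₂, z₁, z₂].Nodup) (hq : G.Adj b q)
    (hx₁ : G.Adj b x₁) (hx₂ : G.Adj b x₂) (hy₁ : G.Adj x₁ y₁) (hy₂ : G.Adj x₂ y₂)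
    (hz₁ : G.Adj y₁ z₁) (hz₂ : G.Adj y₂ z₂) : HasInfinitePlay G := by
  refine hasInfinitePlay_of_table (n := 8) (N := 18)
    [(0, 1), (0, 2), (0, 3), (2, 4), (3, 5), (4, 6), (5, 7)]
    ![1, 2, 0, 3, 5, 6, 4, 2, 0, 1, 3, 0, 2, 4, 7, 5, 3, 0]
    ![![0, 2, 2, 1, 0, 1, 2, 1], ![1, 0, 2, 1, 0, 1, 2, 1], ![2, 0, 0, 1, 1, 1, 2, 1],
      ![0, 1, 1, 2, 1, 1, 2, 1], ![1, 1, 1, 0, 1, 2, 2, 1], ![1, 1, 1, 1, 1, 0, 2, 2],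
      ![1, 1, 1, 1, 2, 0, 0, 2], ![1, 1, 2, 1, 0, 0, 1, 2], ![2, 1, 0, 1, 1, 0, 1, 2],
      ![0, 2, 1, 2, 1, 0, 1, 2], ![1, 0, 1, 2, 1, 0, 1, 2], ![2, 0, 1, 0, 1, 1, 1, 2],
      ![0, 1, 2, 1, 1, 1, 1, 2], ![1, 1, 0, 1, 2, 1, 1, 2], ![1, 1, 1, 1, 0, 1, 2, 2],
      ![1, 1, 1, 1, 0, 2, 2, 0], ![1, 1, 1, 2, 0, 0, 2, 1], ![2, 1, 1, 0, 0, 1, 2, 1]]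
    (by decide) (by decide) (by decide)
    (List.nodup_iff_injective_get.1 hn) ?_
  simp [hq, hx₁, hx₂, hy₁, hy₂, hz₁, hz₂]

theorem hasInfinitePlay_of_cycle {n : ℕ} {c : Fin (n + 3) → V} (hc : Function.Injective c)
    (hadj : ∀ t, G.Adj (c t) (c (t + 1))) : HasInfinitePlay G := by
  -- The firing travels around the cycle: `c t` is next, and only its predecessor has counter `0`.
  refine ⟨{σ | ∃ t, 2 ≤ σ (c t) ∧ ∀ s, s + 1 ≠ t → 1 ≤ σ (c s)},
    ⟨0, le_rfl, fun _ _ => one_le_two⟩, ?_⟩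
  rintro σ ⟨t, ht, hs⟩
  refine ⟨c t, ht, t + 1, ?_, fun s hst => ?_⟩
  · have hne : t + 1 + 1 ≠ t := fun he => by
      rw [add_assoc, add_eq_left, Fin.ext_iff, Fin.val_add, Fin.val_one, Fin.val_zero,
        Nat.mod_eq_of_lt (by omega)] at he
      omega
    rw [fire_of_adj (hadj t)]
    exact Nat.succ_le_succ (hs _ hne)
  · rw [Ne, add_left_inj] at hst
    by_cases hpred : s + 1 = t
    · rw [← hpred, fire_of_adj (hadj s).symm]
      omega
    · exact (hs s hpred).trans (le_fire (hc.ne hst) σ)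

/-- The vertices `p 0, …, p L` are distinct, and consecutive ones are adjacent. The values of `p`
beyond `L` are irrelevant. -/
structure IsPathSeq (G : SimpleGraph V) (p : ℕ → V) (L : ℕ) : Prop where
  inj : ∀ s t, s ≤ L → t ≤ L → p s = p t → s = t
  adj : ∀ t, t < L → G.Adj (p t) (p (t + 1))

theorem IsPathSeq.reverse {p : ℕ → V} {L : ℕ} (hp : IsPathSeq G p L) :
    IsPathSeq G (fun t => p (L - t)) L where
  inj s t hs ht he := by
    have := hp.inj _ _ (by omega) (by omega) he
    omega
  adj t ht := by
    have := hp.adj (L - (t + 1)) (by omega)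
    rw [show L - (t + 1) + 1 = L - t by omega] at this
    exact this.symm

/-- The path `p 0, …, p k`, with two more neighbours `a`, `a'` of `p 0` and two more neighbours
`c`, `c'` of `p k`. For `k = 0` this is a vertex with four neighbours. -/
structure IsForkedPath (G : SimpleGraph V) (k : ℕ) (a a' : V) (p : ℕ → V) (c c' : V) : Prop
    extends IsPathSeq G p k where
  adj_a : G.Adj (p 0) a
  adj_a' : G.Adj (p 0) a'
  adj_c : G.Adj (p k) c
  adj_c' : G.Adj (p k) c'
  nodup : [a, a', c, c'].Nodup
  notMem : ∀ t ≤ k, p t ∉ [a, a', c, c']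

theorem IsForkedPath.reverse {k : ℕ} {a a' c c' : V} {p : ℕ → V}
    (hp : IsForkedPath G k a a' p c c') :
    IsForkedPath G k c c' (fun t => p (k - t)) a a' where
  toIsPathSeq := hp.toIsPathSeq.reverse
  adj_a := by simpa using hp.adj_c
  adj_a' := by simpa using hp.adj_c'
  adj_c := by simpa using hp.adj_a
  adj_c' := by simpa using hp.adj_a'
  nodup := by
    have := hp.nodup
    grind
  notMem t ht := by
    have := hp.notMem (k - t) (by omega)
    grind

/-- The states met while the firing moves along a forked path of length `k`: first both leaves of
one end, then the vertices of the path, and then the same backwards from the other end. -/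
inductive ForkState (G : SimpleGraph V) (k : ℕ) (σ : V → ℕ) : Prop
  | leaves {a a' p c c'} (hp : IsForkedPath G k a a' p c c') (hc : 1 ≤ σ c) (hc' : 1 ≤ σ c')
      (ha : 2 ≤ σ a) (ha' : 2 ≤ σ a') (hs : ∀ s ≤ k, s ≠ 0 → 1 ≤ σ (p s))
  | leaf {a a' p c c'} (hp : IsForkedPath G k a a' p c c') (hc : 1 ≤ σ c) (hc' : 1 ≤ σ c')
      (ha' : 2 ≤ σ a') (hs : ∀ s ≤ k, 1 ≤ σ (p s))
  | path {a a' p c c'} (hp : IsForkedPath G k a a' p c c') (hc : 1 ≤ σ c) (hc' : 1 ≤ σ c')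
      (t : ℕ) (htk : t ≤ k) (ht : 2 ≤ σ (p t)) (hs : ∀ s ≤ k, s ≠ t → s + 1 ≠ t → 1 ≤ σ (p s))
      (ha : t ≠ 0 → 1 ≤ σ a ∧ 1 ≤ σ a')

theorem IsForkedPath.forkState_fire_path {k t : ℕ} {a a' c c' : V} {p : ℕ → V} {σ : V → ℕ}
    (hp : IsForkedPath G k a a' p c c') (hc : 1 ≤ σ c) (hc' : 1 ≤ σ c') (htk : t ≤ k)
    (hs : ∀ s ≤ k, s ≠ t → s + 1 ≠ t → 1 ≤ σ (p s)) (ha : t ≠ 0 → 1 ≤ σ a ∧ 1 ≤ σ a') :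
    ForkState G k (fire G (p t) σ) := by
  have hnotMem := hp.notMem t htk
  simp only [List.mem_cons, List.not_mem_nil, or_false, not_or] at hnotMem
  obtain ⟨hpa, hpa', hpc, hpc'⟩ := hnotMem
  have ha_fire : 1 ≤ fire G (p t) σ a ∧ 1 ≤ fire G (p t) σ a' := by
    rcases eq_or_ne t 0 with rfl | h0
    · rw [fire_of_adj hp.adj_a, fire_of_adj hp.adj_a']
      omega
    · exact ⟨(ha h0).1.trans (le_fire (Ne.symm hpa) σ), (ha h0).2.trans (le_fire (Ne.symm hpa') σ)⟩
  have hp_fire : ∀ s ≤ k, s ≠ t → 1 ≤ fire G (p t) σ (p s) := by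
    intro s hsk hst
    by_cases hpred : s + 1 = t
    · rw [← hpred, fire_of_adj (hp.adj s (by omega)).symm]
      omega
    · exact (hs s hsk hst hpred).trans (le_fire (fun he => hst (hp.inj _ _ hsk htk he)) σ)
  rcases htk.lt_or_eq with hlt | rfl
  · refine .path hp (hc.trans (le_fire (Ne.symm hpc) σ)) (hc'.trans (le_fire (Ne.symm hpc') σ))
      (t + 1) hlt ?_ (fun s hsk _ hst => hp_fire s hsk (by omega)) fun _ => ha_fire
    rw [fire_of_adj (hp.adj t hlt)]
    exact Nat.succ_le_succ (hs (t + 1) hlt (by omega) (by omega))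
  · refine .leaves hp.reverse ha_fire.1 ha_fire.2 ?_ ?_
      fun s _ h0 => hp_fire _ (by omega) (by omega)
    · rw [fire_of_adj hp.adj_c]
      omega
    · rw [fire_of_adj hp.adj_c']
      omega

theorem ForkState.exists_fire {k : ℕ} {σ : V → ℕ} (hσ : ForkState G k σ) :
    ∃ i, 2 ≤ σ i ∧ ForkState G k (fire G i σ) := by
  rcases hσ with ⟨hp, hc, hc', ha, ha', hs⟩ | ⟨hp, hc, hc', ha', hs⟩ |
    ⟨hp, hc, hc', t, htk, ht, hs, ha⟩
  · have hnodup := hp.nodup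
    simp only [List.nodup_cons, List.mem_cons, List.not_mem_nil, or_false, not_or] at hnodup
    obtain ⟨⟨haa', hac, hac'⟩, -⟩ := hnodup
    refine ⟨_, ha, .leaf hp (hc.trans (le_fire (Ne.symm hac) σ))
      (hc'.trans (le_fire (Ne.symm hac') σ)) (ha'.trans (le_fire (Ne.symm haa') σ))
      fun s hsk => ?_⟩
    rcases eq_or_ne s 0 with rfl | h0
    · rw [fire_of_adj hp.adj_a.symm]
      omega
    · exact (hs s hsk h0).trans (le_fire (List.ne_of_not_mem_cons (hp.notMem s hsk)) σ)
  · have hnodup := hp.nodup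
    simp only [List.nodup_cons, List.mem_cons, List.not_mem_nil, or_false, not_or] at hnodup
    obtain ⟨-, ⟨hac, hac'⟩, -⟩ := hnodup
    refine ⟨_, ha', .path hp (hc.trans (le_fire (Ne.symm hac) σ))
      (hc'.trans (le_fire (Ne.symm hac') σ)) 0 (Nat.zero_le k) ?_ (fun s hsk _ _ => ?_)
      fun h0 => absurd rfl h0⟩
    · rw [fire_of_adj hp.adj_a'.symm]
      exact Nat.succ_le_succ (hs 0 (Nat.zero_le k))
    · exact (hs s hsk).trans (le_fire (List.ne_of_not_mem_cons
        (List.not_mem_of_not_mem_cons (hp.notMem s hsk))) σ)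
  · exact ⟨_, ht, hp.forkState_fire_path hc hc' htk hs ha⟩

theorem IsForkedPath.hasInfinitePlay {k : ℕ} {a a' c c' : V} {p : ℕ → V}
    (hp : IsForkedPath G k a a' p c c') : HasInfinitePlay G :=
  ⟨{σ | ForkState G k σ}, .leaves hp one_le_two one_le_two le_rfl le_rfl
    fun _ _ _ => one_le_two, fun _ hσ => hσ.exists_fire⟩

end FiringGame

/-! ### Infinitely many fully commutative elements -/

section InfinitelyMany

variable {B W : Type*} [Group W] {M : CoxeterMatrix B} (cs : CoxeterSystem M W)

theorem IsLegalFiring.of_shortBraidMove {σ : B → ℕ} {ω ω' : List B}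
    (hω : IsLegalFiring M.coxeterGraph σ ω) (hmove : ShortBraidMove M ω ω') :
    IsLegalFiring M.coxeterGraph σ ω' := by
  obtain ⟨u, v, i, j, hij, rfl, rfl⟩ := hmove
  rw [List.append_assoc] at hω ⊢
  obtain ⟨τ, ⟨hi, hj, hv⟩, hτ⟩ := hω.exists_state
  have hne : i ≠ j := by
    rintro rfl
    rw [M.diagonal] at hij
    omega
  have hnadj : ¬M.coxeterGraph.Adj i j := fun hadj => by
    have := hadj.2
    omega
  rw [fire_of_not_adj hne.symm hnadj] at hj
  refine hτ _ ⟨hj, ?_, ?_⟩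
  · rwa [fire_of_not_adj hne fun hadj => hnadj hadj.symm]
  · rwa [fire_comm hne hnadj]

theorem IsLegalFiring.isStable {σ : B → ℕ} {ω : List B}
    (hω : IsLegalFiring M.coxeterGraph σ ω) : IsStable M ω := by
  intro ω' hequiv
  have hω' : IsLegalFiring M.coxeterGraph σ ω' := by
    induction hequiv with
    | refl => exact hω
    | tail _ hmove ih => exact ih.of_shortBraidMove hmove
  constructor
  · rintro u v i rfl
    rw [List.append_assoc] at hω'
    obtain ⟨τ, ⟨-, hi, -⟩, -⟩ := hω'.exists_state
    rw [fire_self] at hi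
    omega
  · rintro u v i j hij rfl
    rw [List.append_assoc] at hω'
    obtain ⟨τ, ⟨-, -, hi, -⟩, -⟩ := hω'.exists_state
    have hadj : M.coxeterGraph.Adj j i := ⟨(ne_of_eq_three hij).symm, M.symmetric i j ▸ hij⟩
    rw [fire_of_adj hadj, fire_self] at hi
    omega

theorem infinite_fullyCommutative_of_hasInfinitePlay (h : M.IsSimplyLaced)
    (hG : HasInfinitePlay M.coxeterGraph) : {w : W | cs.IsFullyCommutative w}.Infinite := by
  refine Set.Infinite.of_image cs.length (Set.infinite_of_forall_exists_gt fun n => ?_)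
  obtain ⟨ω, hlen, hω⟩ := hG.exists_isLegalFiring (n + 1)
  refine ⟨_, ⟨_, hω.isStable.isFullyCommutative cs h, rfl⟩, ?_⟩
  rw [(hω.isStable.isReduced_and_shortBraidEquiv cs h).1.eq]
  omega

theorem simple_injective (h : M.IsSimplyLaced) : Function.Injective cs.simple := by
  intro i j hij
  by_contra hne
  have hself := simple_apply_self cs h i
  rw [hij, simple_apply_simpleRoot] at hself
  have hcoeff := DFunLike.congr_fun hself i
  simp [CoxeterMatrix.simpleRoot, Ne.symm hne] at hcoeff
  norm_num at hcoeff

theorem infinite_fullyCommutative_of_infinite (h : M.IsSimplyLaced) [Infinite B] :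
    {w : W | cs.IsFullyCommutative w}.Infinite := by
  refine Set.infinite_of_injective_forall_mem (simple_injective cs h) fun i => ?_
  rw [Set.mem_ofPred_eq, ← wordProd_singleton]
  have hlegal : IsLegalFiring M.coxeterGraph (fun _ => 2) [i] := ⟨le_rfl, trivial⟩
  exact hlegal.isStable.isFullyCommutative cs h

end InfinitelyMany

/-! ### Graphs without infinite plays -/

section NoInfinitePlay

variable {V : Type*} {G : SimpleGraph V}

theorem isContained_coxeterGraphE {g : V → ℕ} (hg : Function.Injective g) {n : ℕ}
    (hlt : ∀ v, g v < n)
    (hadj : ∀ v w, G.Adj v w → g v < g w → 1 ≤ g v ∧ g v + 1 = g w ∨ g v = 0 ∧ g w = 3) :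
    G.IsContained (coxeterGraphE n) := by
  refine ⟨⟨⟨fun v => ⟨g v, hlt v⟩, fun {v w} hvw => ?_⟩, fun v w he => hg (Fin.mk.inj_iff.1 he)⟩⟩
  rw [coxeterGraphE, SimpleGraph.fromRel_adj]
  have hne : g v ≠ g w := hg.ne hvw.ne
  refine ⟨fun he => hne (Fin.mk.inj_iff.1 he), ?_⟩
  rcases hne.lt_or_gt with hl | hl
  · exact .inl (hadj v w hvw hl)
  · exact .inr (hadj w v hvw.symm hl)

theorem exists_adj_boundary (hG : G.Connected) {S : Set V} {v w : V} (hv : v ∈ S) (hw : w ∉ S) :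
    ∃ a ∈ S, ∃ b ∉ S, G.Adj a b := by
  obtain ⟨p⟩ := hG.preconnected v w
  obtain ⟨d, -, hfst, hsnd⟩ := p.exists_boundary_dart S hv hw
  exact ⟨d.fst, hfst, d.snd, hsnd, d.adj⟩

namespace IsPathSeq

variable {p : ℕ → V} {L : ℕ}

theorem ne (hp : IsPathSeq G p L) {s t : ℕ} (hs : s ≤ L) (ht : t ≤ L) (hst : s ≠ t) :
    p s ≠ p t :=
  fun he => hst (hp.inj _ _ hs ht he)

theorem length_lt_card [Finite V] (hp : IsPathSeq G p L) : L < Nat.card V := by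
  have hinj : Function.Injective fun t : Fin (L + 1) => p t := fun s t he =>
    Fin.ext (hp.inj _ _ (by omega) (by omega) he)
  simpa using Nat.card_le_card_of_injective _ hinj

theorem cons (hp : IsPathSeq G p L) {q : V} (hq : ∀ t ≤ L, p t ≠ q) (ha : G.Adj q (p 0)) :
    IsPathSeq G (fun t => if t = 0 then q else p (t - 1)) (L + 1) where
  inj s t hs ht he := by
    split_ifs at he
    · omega
    · exact absurd he.symm (hq _ (by omega))
    · exact absurd he (hq _ (by omega))
    · have := hp.inj _ _ (by omega) (by omega) he
      omega
  adj t ht := by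
    rcases t with - | t
    · simpa using ha
    · simpa using hp.adj t (by omega)

theorem drop (hp : IsPathSeq G p L) (i : ℕ) (hi : i ≤ L) :
    IsPathSeq G (fun t => p (i + t)) (L - i) where
  inj s t hs ht he := by
    have := hp.inj _ _ (by omega) (by omega) he
    omega
  adj t ht := hp.adj (i + t) (by omega)

theorem take (hp : IsPathSeq G p L) {k : ℕ} (hk : k ≤ L) : IsPathSeq G p k where
  inj s t hs ht := hp.inj s t (hs.trans hk) (ht.trans hk)
  adj t ht := hp.adj t (ht.trans_le hk)

theorem eq_succ_of_adj (hp : IsPathSeq G p L) (hG : ¬HasInfinitePlay G) {s t : ℕ} (hst : s < t)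
    (ht : t ≤ L) (ha : G.Adj (p s) (p t)) : t = s + 1 := by
  by_contra hne
  obtain ⟨n, rfl⟩ : ∃ n, t = s + (n + 2) := ⟨t - s - 2, by omega⟩
  refine hG (hasInfinitePlay_of_cycle (n := n) (c := fun u => p (s + u)) (fun u v he => ?_)
    (Fin.lastCases ?_ fun u => ?_))
  · have := hp.inj _ _ (by omega) (by omega) he
    omega
  · simpa using ha.symm
  · rw [Fin.coeSucc_eq_succ]
    exact hp.adj (s + u) (by omega)

theorem not_adj_of_adj (hp : IsPathSeq G p L) (hG : ¬HasInfinitePlay G) {q : V}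
    (hq : ∀ t ≤ L, p t ≠ q) {s t : ℕ} (hst : s < t) (ht : t ≤ L) (has : G.Adj q (p s)) :
    ¬G.Adj q (p t) := by
  intro hat
  have hcons := (hp.drop s (by omega)).cons (fun u hu => hq _ (by omega)) has
  have := hcons.eq_succ_of_adj hG (s := 0) (t := t - s + 1) (by omega) (by omega)
    (by simpa [show s + (t - s) = t by omega] using hat)
  omega

theorem hasInfinitePlay_of_branches (hp : IsPathSeq G p L) {q r : V} (hq : ∀ t ≤ L, p t ≠ q)
    (hr : ∀ t ≤ L, p t ≠ r) (hqr : q ≠ r) {i j : ℕ} (hi : 1 ≤ i) (hij : i ≤ j) (hj : j + 1 ≤ L)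
    (hiq : G.Adj (p i) q) (hjr : G.Adj (p j) r) : HasInfinitePlay G := by
  have hji : i + (j - i) = j := by omega
  have hpath : IsPathSeq G (fun t => p (i + t)) (j - i) :=
    (hp.drop i (by omega)).take (by omega)
  refine IsForkedPath.hasInfinitePlay (k := j - i) (a := q) (a' := p (i - 1))
    (p := fun t => p (i + t)) (c := r) (c' := p (j + 1))
    ⟨hpath, hiq, ?_, ?_, ?_, ?_, fun t ht => ?_⟩
  · have := (hp.adj (i - 1) (by omega)).symm
    rwa [Nat.sub_add_cancel hi] at this
  · rwa [hji]
  · rw [hji]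
    exact hp.adj j (by omega)
  · have hends := hp.ne (s := i - 1) (t := j + 1) (by omega) (by omega) (by omega)
    grind
  · have hprev := hp.ne (s := i + t) (t := i - 1) (by omega) (by omega) (by omega)
    have hnext := hp.ne (s := i + t) (t := j + 1) (by omega) (by omega) (by omega)
    grind

theorem hasInfinitePlay_of_tail (hp : IsPathSeq G p L) {q r : V} (hq : ∀ t ≤ L, p t ≠ q)
    (hr : ∀ t ≤ L, p t ≠ r) {i : ℕ} (hi : 2 ≤ i) (hiL : i + 2 ≤ L) (hiq : G.Adj (p i) q)
    (hqr : G.Adj q r) : HasInfinitePlay G := by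
  obtain ⟨i, rfl⟩ := Nat.exists_eq_add_of_le' hi
  refine hasInfinitePlay_of_arms_two (b := p (i + 2)) (x₁ := p (i + 1)) (x₂ := p (i + 3))
    (x₃ := q) (y₁ := p i) (y₂ := p (i + 4)) (y₃ := r) ?_ (hp.adj (i + 1) (by omega)).symm
    (hp.adj (i + 2) (by omega)) hiq (hp.adj i (by omega)).symm (hp.adj (i + 3) (by omega)) hqr
  have hinj := hp.inj
  have hne := hqr.ne
  grind

theorem hasInfinitePlay_of_middle (hp : IsPathSeq G p L) {q : V} (hq : ∀ t ≤ L, p t ≠ q) {i : ℕ}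
    (hi : 3 ≤ i) (hiL : i + 3 ≤ L) (hiq : G.Adj (p i) q) : HasInfinitePlay G := by
  obtain ⟨i, rfl⟩ := Nat.exists_eq_add_of_le' hi
  refine hasInfinitePlay_of_arms_one_three_three (b := p (i + 3)) (q := q) (x₁ := p (i + 2))
    (x₂ := p (i + 4)) (y₁ := p (i + 1)) (y₂ := p (i + 5)) (z₁ := p i) (z₂ := p (i + 6)) ?_ hiq
    (hp.adj (i + 2) (by omega)).symm (hp.adj (i + 3) (by omega)) (hp.adj (i + 1) (by omega)).symm
    (hp.adj (i + 4) (by omega)) (hp.adj i (by omega)).symm (hp.adj (i + 5) (by omega))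
  have hinj := hp.inj
  grind

theorem isContained_coxeterGraphE_of_forall_mem (hp : IsPathSeq G p L) (hG : ¬HasInfinitePlay G)
    (hcov : ∀ v, ∃ t ≤ L, p t = v) : ∃ n, 6 ≤ n ∧ G.IsContained (coxeterGraphE n) := by
  choose idx hidx_le hidx using hcov
  refine ⟨L + 6, by omega, isContained_coxeterGraphE (g := fun v => idx v + 1) ?_ ?_ ?_⟩
  · intro v w he
    rw [← hidx v, ← hidx w, Nat.succ_injective he]
  · intro v
    have := hidx_le v
    omega
  · intro v w hvw hlt
    rw [← hidx v, ← hidx w] at hvw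
    have := hp.eq_succ_of_adj hG (by omega) (hidx_le w) hvw
    omega

-- The vertex `q` becomes the vertex `0` of the graph of type `E`, and `p i` the vertex `3`.
theorem isContained_coxeterGraphE_of_adj (hp : IsPathSeq G p L) (hG : ¬HasInfinitePlay G) {q : V}
    (hq : ∀ t ≤ L, p t ≠ q) (hcov : ∀ v, v = q ∨ ∃ t ≤ L, p t = v) {i : ℕ} (hi : i ≤ 2)
    (hiL : i ≤ L) (ha : G.Adj q (p i)) : ∃ n, 6 ≤ n ∧ G.IsContained (coxeterGraphE n) := by
  classical
  have hcov' : ∀ v, ∃ t, v ≠ q → t ≤ L ∧ p t = v := fun v => by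
    rcases hcov v with rfl | ⟨t, ht⟩
    · exact ⟨0, fun hne => absurd rfl hne⟩
    · exact ⟨t, fun _ => ht⟩
  choose idx hidx using hcov'
  refine ⟨L + 6, by omega, isContained_coxeterGraphE
    (g := fun v => if v = q then 0 else idx v + (3 - i)) ?_ ?_ ?_⟩
  · intro v w he
    dsimp only at he
    split_ifs at he with hv hw hw
    · rw [hv, hw]
    · omega
    · omega
    · rw [← (hidx v hv).2, ← (hidx w hw).2, show idx v = idx w by omega]
  · intro v
    split_ifs with hv
    · omega
    · have := (hidx v hv).1
      omega
  · intro v w hvw hlt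
    split_ifs at hlt ⊢ with hv hw hw
    · exact absurd hvw (hv ▸ hw ▸ G.loopless.irrefl _)
    · obtain ⟨hle, heq⟩ := hidx w hw
      rw [hv, ← heq] at hvw
      rcases lt_trichotomy (idx w) i with hlt | hidx_eq | hgt
      · exact absurd ha (hp.not_adj_of_adj hG hq hlt hiL hvw)
      · omega
      · exact absurd hvw (hp.not_adj_of_adj hG hq hgt hle ha)
    · omega
    · obtain ⟨hle, heq⟩ := hidx w hw
      rw [← (hidx v hv).2, ← heq] at hvw
      have := hp.eq_succ_of_adj hG (by omega) hle hvw
      omega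

end IsPathSeq

/-- A path with the largest possible number of vertices. -/
structure IsLongestPathSeq (G : SimpleGraph V) (p : ℕ → V) (L : ℕ) : Prop
    extends IsPathSeq G p L where
  length_le : ∀ p' L', IsPathSeq G p' L' → L' ≤ L

theorem exists_isLongestPathSeq (G : SimpleGraph V) [Finite V] [Nonempty V] :
    ∃ p L, IsLongestPathSeq G p L := by
  classical
  let P : ℕ → Prop := fun L => ∃ p, IsPathSeq G p L
  have hsingle : P 0 := ⟨fun _ => Classical.arbitrary V, fun s t hs ht _ => by omega,
    fun t ht => by omega⟩
  obtain ⟨p, hp⟩ := Nat.findGreatest_spec (P := P) (Nat.zero_le (Nat.card V)) hsingle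
  exact ⟨p, _, hp, fun p' L' hp' => Nat.le_findGreatest hp'.length_lt_card.le ⟨p', hp'⟩⟩

namespace IsLongestPathSeq

variable {p : ℕ → V} {L : ℕ}

theorem reverse (hp : IsLongestPathSeq G p L) : IsLongestPathSeq G (fun t => p (L - t)) L :=
  ⟨hp.toIsPathSeq.reverse, hp.length_le⟩

theorem one_le_of_adj (hp : IsLongestPathSeq G p L) {q : V} (hq : ∀ t ≤ L, p t ≠ q) {i : ℕ}
    (hi : i ≤ L) (ha : G.Adj q (p i)) : 1 ≤ i := by
  have := hp.length_le _ _ ((hp.drop i hi).cons (fun u hu => hq _ (by omega)) ha)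
  omega

theorem lt_of_adj (hp : IsLongestPathSeq G p L) {q : V} (hq : ∀ t ≤ L, p t ≠ q) {i : ℕ}
    (hi : i ≤ L) (ha : G.Adj q (p i)) : i < L := by
  have := hp.reverse.one_le_of_adj (fun t _ => hq _ (by omega)) (Nat.sub_le L i)
    (by rwa [Nat.sub_sub_self hi])
  omega

theorem two_le_of_adj_adj (hp : IsLongestPathSeq G p L) {q r : V} (hq : ∀ t ≤ L, p t ≠ q)
    (hr : ∀ t ≤ L, p t ≠ r) {i : ℕ} (hi : i ≤ L) (hqi : G.Adj q (p i)) (hrq : G.Adj r q) :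
    2 ≤ i := by
  have hcons := (hp.drop i hi).cons (fun u hu => hq _ (by omega)) hqi
  have := hp.length_le _ _ (hcons.cons (q := r) (fun u hu => ?_) hrq)
  · omega
  · split_ifs
    · exact hrq.ne'
    · exact hr _ (by omega)

theorem add_two_le_of_adj_adj (hp : IsLongestPathSeq G p L) {q r : V} (hq : ∀ t ≤ L, p t ≠ q)
    (hr : ∀ t ≤ L, p t ≠ r) {i : ℕ} (hi : i ≤ L) (hqi : G.Adj q (p i)) (hrq : G.Adj r q) :
    i + 2 ≤ L := by
  have := hp.reverse.two_le_of_adj_adj (fun t _ => hq _ (by omega)) (fun t _ => hr _ (by omega))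
    (Nat.sub_le L i) (by rwa [Nat.sub_sub_self hi]) hrq
  omega

theorem eq_or_exists_eq (hp : IsLongestPathSeq G p L) (hc : G.Connected)
    (hG : ¬HasInfinitePlay G) {q : V} (hq : ∀ t ≤ L, p t ≠ q) {i : ℕ} (hi : i ≤ L)
    (hiq : G.Adj (p i) q) (v : V) : v = q ∨ ∃ t ≤ L, p t = v := by
  by_contra hv
  obtain ⟨a, ha, r, hr, har⟩ := exists_adj_boundary hc
    (S := {v | v = q ∨ ∃ t ≤ L, p t = v}) (.inl rfl) hv
  have hrq : r ≠ q := fun he => hr (.inl he)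
  have hrp : ∀ t ≤ L, p t ≠ r := fun t ht he => hr (.inr ⟨t, ht, he⟩)
  rcases ha with rfl | ⟨j, hj, rfl⟩
  · exact hG (hp.hasInfinitePlay_of_tail hq hrp (hp.two_le_of_adj_adj hq hrp hi hiq.symm har.symm)
      (hp.add_two_le_of_adj_adj hq hrp hi hiq.symm har.symm) hiq har)
  · rcases le_total i j with hij | hji
    · exact hG (hp.hasInfinitePlay_of_branches hq hrp hrq.symm (hp.one_le_of_adj hq hi hiq.symm)
        hij (hp.lt_of_adj hrp hj har.symm) hiq har)
    · exact hG (hp.hasInfinitePlay_of_branches hrp hq hrq (hp.one_le_of_adj hrp hj har.symm)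
        hji (hp.lt_of_adj hq hi hiq.symm) har hiq)

end IsLongestPathSeq

theorem exists_isContained_coxeterGraphE [Finite V] (hc : G.Connected) (hG : ¬HasInfinitePlay G) :
    ∃ n, 6 ≤ n ∧ G.IsContained (coxeterGraphE n) := by
  have := hc.nonempty
  obtain ⟨p, L, hp⟩ := exists_isLongestPathSeq G
  by_cases hspan : ∀ v, ∃ t ≤ L, p t = v
  · exact hp.isContained_coxeterGraphE_of_forall_mem hG hspan
  obtain ⟨v₀, hv₀⟩ := not_forall.1 hspan
  obtain ⟨_, ⟨i, hi, rfl⟩, q, hq, hiq⟩ := exists_adj_boundary hc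
    (S := {v | ∃ t ≤ L, p t = v}) ⟨0, Nat.zero_le L, rfl⟩ hv₀
  replace hq : ∀ t ≤ L, p t ≠ q := fun t ht he => hq ⟨t, ht, he⟩
  have hcov := hp.eq_or_exists_eq hc hG hq hi hiq
  by_cases hnear : i ≤ 2
  · exact hp.isContained_coxeterGraphE_of_adj hG hq hcov hnear hi hiq.symm
  by_cases hfar : L - i ≤ 2
  · refine hp.reverse.isContained_coxeterGraphE_of_adj hG (fun t _ => hq _ (by omega))
      (fun v => (hcov v).imp_right ?_) hfar (Nat.sub_le L i)
      (by rw [Nat.sub_sub_self hi]; exact hiq.symm)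
    rintro ⟨t, ht, rfl⟩
    exact ⟨L - t, Nat.sub_le L t, by rw [Nat.sub_sub_self ht]⟩
  · exact absurd (hp.hasInfinitePlay_of_middle hq (by omega) (by omega) hiq) hG

end NoInfinitePlay

/-! ### Factors of reduced expressions of maximally clustered elements -/

section ClusterFactor

variable {B W : Type*} [Group W] {M : CoxeterMatrix B}

/-- The number of letters of `x` joined to `i` in the Coxeter graph. -/
def nbCount (M : CoxeterMatrix B) (i : B) (x : List B) : ℕ := x.countP fun j => M i j = 3

theorem nbCount_append (i : B) (x y : List B) :
    nbCount M i (x ++ y) = nbCount M i x + nbCount M i y := List.countP_append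

theorem nbCount_cons_of_eq_three {i j : B} (hij : M i j = 3) (x : List B) :
    nbCount M i (j :: x) = nbCount M i x + 1 := by simp [nbCount, hij]

theorem nbCount_eq_zero_iff {i : B} {x : List B} : nbCount M i x = 0 ↔ ∀ j ∈ x, M i j ≠ 3 := by
  simp [nbCount, List.countP_eq_zero]

theorem nbCount_cons_eq_zero_iff {i j : B} {x : List B} :
    nbCount M i (j :: x) = 0 ↔ M i j ≠ 3 ∧ nbCount M i x = 0 := by
  simp [nbCount_eq_zero_iff]

theorem exists_eq_append_of_nbCount_pos {i : B} {x : List B} (hx : 0 < nbCount M i x) :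
    ∃ x₁ j x₂, x = x₁ ++ j :: x₂ ∧ M i j = 3 := by
  obtain ⟨j, hj, hij⟩ := List.countP_pos_iff.1 hx
  obtain ⟨x₁, x₂, rfl⟩ := List.append_of_mem hj
  exact ⟨x₁, j, x₂, rfl, by simpa using hij⟩

theorem exists_eq_append_of_nbCount_eq_one {i : B} {x : List B} (hx : nbCount M i x = 1) :
    ∃ x₁ j x₂, x = x₁ ++ j :: x₂ ∧ M i j = 3 ∧ nbCount M i x₁ = 0 ∧ nbCount M i x₂ = 0 := by
  obtain ⟨x₁, j, x₂, rfl, hij⟩ := exists_eq_append_of_nbCount_pos (hx ▸ one_pos)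
  rw [nbCount_append, nbCount_cons_of_eq_three hij] at hx
  exact ⟨x₁, j, x₂, rfl, hij, by omega, by omega⟩

variable (cs : CoxeterSystem M W)

/-- Words with the same product, the same length and the same letters. This is coarser than
equality up to braid moves, but retains all that is needed about the word. -/
structure WordEquiv (ω ω' : List B) : Prop where
  wordProd_eq : cs.wordProd ω = cs.wordProd ω'
  length_eq : ω.length = ω'.length
  mem_iff : ∀ j, j ∈ ω ↔ j ∈ ω'

namespace WordEquiv

variable {cs} {ω₁ ω₂ ω₃ : List B}

theorem refl (ω : List B) : WordEquiv cs ω ω := ⟨rfl, rfl, fun _ => Iff.rfl⟩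

theorem symm (e : WordEquiv cs ω₁ ω₂) : WordEquiv cs ω₂ ω₁ :=
  ⟨e.1.symm, e.2.symm, fun j => (e.3 j).symm⟩

theorem trans (e : WordEquiv cs ω₁ ω₂) (e' : WordEquiv cs ω₂ ω₃) : WordEquiv cs ω₁ ω₃ :=
  ⟨e.1.trans e'.1, e.2.trans e'.2, fun j => (e.3 j).trans (e'.3 j)⟩

theorem append (u v : List B) (e : WordEquiv cs ω₁ ω₂) :
    WordEquiv cs (u ++ ω₁ ++ v) (u ++ ω₂ ++ v) :=
  ⟨by simp [wordProd_append, e.1], by simp [e.2], fun j => by simp [e.3 j]⟩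

theorem isReduced (e : WordEquiv cs ω₁ ω₂) (hω : cs.IsReduced ω₁) : cs.IsReduced ω₂ := by
  rw [CoxeterSystem.IsReduced, ← e.1, ← e.2, hω.eq]

end WordEquiv

variable (h : M.IsSimplyLaced)

include h in
theorem wordEquiv_cons_cons {i j : B} (hij : M i j ≠ 3) (x : List B) :
    WordEquiv cs (i :: j :: x) (j :: i :: x) := by
  refine ⟨?_, rfl, fun k => by simp [or_left_comm]⟩
  rcases eq_or_ne i j with rfl | hne
  · rfl
  · simp only [wordProd_cons, ← mul_assoc,
      simple_mul_simple_comm cs ((h i j hne).resolve_right hij)]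

include h in
theorem wordEquiv_cons_append {i : B} {x : List B} (hx : nbCount M i x = 0) (y : List B) :
    WordEquiv cs (i :: (x ++ y)) (x ++ i :: y) := by
  induction x with
  | nil => exact .refl _
  | cons j x ih =>
    rw [nbCount_cons_eq_zero_iff] at hx
    have htail := (ih hx.2).append [j] []
    exact (wordEquiv_cons_cons cs h hx.1 (x ++ y)).trans (by simpa using htail)

include h in
theorem wordEquiv_gap {i j : B} {x y : List B} (hx : nbCount M i x = 0) (hy : nbCount M i y = 0) :
    WordEquiv cs (i :: (x ++ j :: y) ++ [i]) (x ++ [i, j, i] ++ y) := by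
  have hleft := wordEquiv_cons_append cs h hx (j :: y ++ [i])
  have hright := (wordEquiv_cons_append cs h hy []).symm.append (x ++ [i, j]) []
  simpa using hleft.trans (by simpa using hright)

theorem wordEquiv_braid {i j : B} (hij : M i j = 3) (x y : List B) :
    WordEquiv cs (x ++ [i, j, i] ++ y) (x ++ [j, i, j] ++ y) := by
  have hbraid : WordEquiv cs [i, j, i] [j, i, j] :=
    ⟨by simpa [wordProd_cons, mul_assoc] using simple_mul_simple_mul_simple cs hij, rfl,
      fun k => by simp [or_comm, or_left_comm]⟩
  exact hbraid.append x y

include h in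
theorem wordEquiv_gap_braid {i j : B} {x y : List B} (hij : M i j = 3) (hx : nbCount M i x = 0)
    (hy : nbCount M i y = 0) : WordEquiv cs (i :: (x ++ j :: y) ++ [i]) (x ++ [j, i, j] ++ y) :=
  (wordEquiv_gap cs h hx hy).trans (wordEquiv_braid cs hij x y)

theorem letterRoot_congr {v v' : List B} (e : WordEquiv cs v v') (i : B) :
    letterRoot cs h i v = letterRoot cs h i v' := by
  rw [letterRoot, letterRoot, e.wordProd_eq]

theorem letterRoot_append_of_nbCount_eq_zero {i : B} {x : List B} (hx : nbCount M i x = 0)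
    (hix : i ∉ x) (v : List B) : letterRoot cs h i (x ++ v) = letterRoot cs h i v := by
  induction x with
  | nil => rfl
  | cons j x ih =>
    rw [nbCount_cons_eq_zero_iff] at hx
    rw [List.mem_cons, not_or] at hix
    rw [List.cons_append, letterRoot_cons_of_eq_two cs h ((h i j hix.1).resolve_right hx.1),
      ih hx.2 hix.2]

theorem letterRoot_eq_of_gap {i k : B} {x y z : List B} (hik : M i k = 3)
    (hx : nbCount M i x = 0) (hix : i ∉ x) (hy : nbCount M i y = 0) (hiy : i ∉ y)
    (hz : nbCount M i z = 0) (v : List B) :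
    letterRoot cs h i (x ++ (y ++ k :: z) ++ [i] ++ v) = letterRoot cs h k (z ++ v) := by
  have hcomm := (wordEquiv_cons_append cs h hz v).symm.append [k] []
  simp only [List.append_assoc, List.cons_append, List.nil_append, List.append_nil] at hcomm ⊢
  rw [letterRoot_append_of_nbCount_eq_zero cs h hx hix,
    letterRoot_append_of_nbCount_eq_zero cs h hy hiy, letterRoot_congr cs h hcomm,
    letterRoot_cons_cons_of_eq_three cs h hik]

/-- The word `ω` is a factor of a reduced expression of a maximally clustered element. -/
def IsClusterFactor (ω : List B) : Prop :=
  ∃ u v, cs.IsReduced (u ++ ω ++ v) ∧ cs.IsMaximallyClustered h (cs.wordProd (u ++ ω ++ v))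

namespace IsClusterFactor

variable {cs h}

theorem of_wordEquiv {ω ω' : List B} (hω : IsClusterFactor cs h ω) (e : WordEquiv cs ω ω') :
    IsClusterFactor cs h ω' := by
  obtain ⟨u, v, hr, hmc⟩ := hω
  have huv := e.append u v
  exact ⟨u, v, huv.isReduced hr, huv.wordProd_eq ▸ hmc⟩

theorem factor {u ω v : List B} (hω : IsClusterFactor cs h (u ++ ω ++ v)) :
    IsClusterFactor cs h ω := by
  obtain ⟨u', v', hmc⟩ := hω
  exact ⟨u' ++ u, v ++ v', by simpa using hmc⟩

theorem nbCount_pos {i : B} {x : List B} (hω : IsClusterFactor cs h (i :: x ++ [i])) :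
    0 < nbCount M i x := by
  by_contra hx
  have e := wordEquiv_cons_append cs h (by omega : nbCount M i x = 0) [i]
  obtain ⟨u, v, hr, -⟩ := hω.of_wordEquiv (by simpa using e)
  exact not_isReduced_of_pair cs (u ++ x) v i (by simpa using hr)

-- Each gap contracts to a braid, so it gives a contractible triple. The two triples share the root
-- of the middle `i`, while their highest roots are the distinct roots of `j` and `k`.
theorem not_two_gaps {i : B} {x y : List B} (hω : IsClusterFactor cs h (i :: x ++ i :: y ++ [i]))
    (hix : i ∉ x) (hiy : i ∉ y) (hx : nbCount M i x = 1) : nbCount M i y ≠ 1 := by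
  intro hy
  obtain ⟨x₁, j, x₂, rfl, hij, hx₁, hx₂⟩ := exists_eq_append_of_nbCount_eq_one hx
  obtain ⟨y₁, k, y₂, rfl, hik, hy₁, hy₂⟩ := exists_eq_append_of_nbCount_eq_one hy
  simp only [List.mem_append, List.mem_cons, not_or] at hix hiy
  obtain ⟨u, v, hr, hmc⟩ := hω
  have e := (wordEquiv_gap cs h (j := j) hx₁ hx₂).append u ((y₁ ++ k :: y₂) ++ [i] ++ v)
  have e' := (wordEquiv_gap cs h (j := k) hy₁ hy₂).append (u ++ i :: (x₁ ++ j :: x₂)) v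
  simp only [List.append_assoc, List.cons_append, List.nil_append] at hr hmc e e'
  have hr₁ : cs.IsReducedExpr ((u ++ x₁) ++ [i, j, i] ++ (x₂ ++ (y₁ ++ k :: y₂) ++ [i] ++ v)) _ :=
    ⟨by simpa using e.isReduced hr, by simpa using e.wordProd_eq.symm⟩
  have hr₂ : cs.IsReducedExpr ((u ++ i :: (x₁ ++ j :: x₂) ++ y₁) ++ [i, k, i] ++ (y₂ ++ v)) _ :=
    ⟨by simpa using e'.isReduced hr, by simpa using e'.wordProd_eq.symm⟩
  have hcommon : letterRoot cs h i (x₂ ++ (y₁ ++ k :: y₂) ++ [i] ++ v) =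
      letterRoot cs h k (y₂ ++ v) :=
    letterRoot_eq_of_gap cs h hik hx₂ hix.2.2 hy₁ hiy.1 hy₂ v
  have hhighest := hmc _ _ (isContractibleTriple_braidTriple cs h hij hr₁)
    (isContractibleTriple_braidTriple cs h hik hr₂)
    ⟨letterRoot cs h k (y₂ ++ v), by simp [braidTriple, ← hcommon], by simp [braidTriple]⟩ _ _
    (isHighestRoot_braidTriple cs h hij hr₁) (isHighestRoot_braidTriple cs h hik hr₂)
  rw [add_comm, ← letterRoot_cons_of_eq_three cs h (M.symmetric i j ▸ hij), add_comm,
    ← letterRoot_cons_of_eq_three cs h (M.symmetric i k ▸ hik),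
    letterRoot_congr cs h (wordEquiv_cons_append cs h hy₂ v)] at hhighest
  simp only [List.append_assoc, List.cons_append, List.nil_append] at hhighest
  rw [letterRoot_congr cs h (wordEquiv_cons_append cs h hx₂ _)] at hhighest
  have hfactor : cs.IsReduced (j :: (x₂ ++ i :: y₁)) := by
    refine isReduced_of_append_right cs (u := u ++ i :: x₁)
      (isReduced_of_append_left cs (v := k :: (y₂ ++ i :: v)) ?_)
    simpa using hr
  exact letterRoot_append_cons_ne cs h hfactor k (y₂ ++ i :: v) (by simpa using hhighest)

theorem not_gap_left {i j : B} {p q r : List B} (hij : M i j = 3)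
    (hω : IsClusterFactor cs h (j :: (p ++ i :: q) ++ j :: r ++ [i])) (hjp : j ∉ p) (hjq : j ∉ q)
    (hq : nbCount M i q = 0) (hr : nbCount M i r = 0) : 3 ≤ nbCount M j (p ++ i :: q) := by
  have hji : M j i = 3 := M.symmetric i j ▸ hij
  have e := (wordEquiv_gap_braid cs h hij hq hr).append (j :: p) []
  have hbraid := hω.of_wordEquiv (by simpa using e)
  have hgaps : IsClusterFactor cs h (j :: (p ++ q) ++ j :: [i] ++ [j]) :=
    factor (u := []) (v := r) (by simpa using hbraid)
  have hpos : 0 < nbCount M j (p ++ q) :=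
    (factor (u := []) (v := i :: [j]) (by simpa using hgaps)).nbCount_pos
  have hne : nbCount M j (p ++ q) ≠ 1 := fun hone =>
    hgaps.not_two_gaps (by simp [hjp, hjq]) (by simpa using ne_of_eq_three hji) hone
      (nbCount_cons_of_eq_three hji [])
  rw [nbCount_append] at hpos hne ⊢
  rw [nbCount_cons_of_eq_three hji]
  omega

theorem not_gap_right {i j : B} {p q r : List B} (hij : M i j = 3)
    (hω : IsClusterFactor cs h (i :: r ++ j :: (q ++ i :: p) ++ [j])) (hjp : j ∉ p) (hjq : j ∉ q)
    (hq : nbCount M i q = 0) (hr : nbCount M i r = 0) : 3 ≤ nbCount M j (q ++ i :: p) := by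
  have hji : M j i = 3 := M.symmetric i j ▸ hij
  have e := (wordEquiv_gap_braid cs h hij hr hq).append [] (p ++ [j])
  have hbraid := hω.of_wordEquiv (by simpa using e)
  have hgaps : IsClusterFactor cs h (j :: [i] ++ j :: (q ++ p) ++ [j]) :=
    factor (u := r) (v := []) (by simpa using hbraid)
  have hpos : 0 < nbCount M j (q ++ p) :=
    (factor (u := j :: [i]) (v := []) (by simpa using hgaps)).nbCount_pos
  have hne : nbCount M j (q ++ p) ≠ 1 :=
    hgaps.not_two_gaps (by simpa using ne_of_eq_three hji) (by simp [hjp, hjq])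
      (nbCount_cons_of_eq_three hji [])
  rw [nbCount_append] at hpos hne ⊢
  rw [nbCount_cons_of_eq_three hji]
  omega

end IsClusterFactor

end ClusterFactor

/-! ### Labellings by the vertices of a graph of type `E` -/

section Labelling

variable {B W : Type*} [Group W] {M : CoxeterMatrix B}

/-- The neighbour of the vertex `k ≠ 3` of a graph of type `E` that is closer to the branch
vertex `3`. The value at `3` is junk. -/
def parentE (k : ℕ) : ℕ := if k ≤ 2 then if k = 1 then 2 else 3 else k - 1

/-- The distance of the vertex `k` of a graph of type `E` from the branch vertex `3`. -/
def depthE (k : ℕ) : ℕ := if k = 0 then 1 else if k ≤ 3 then 3 - k else k - 3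

theorem depthE_parentE_add_one {k : ℕ} (hk : k ≠ 3) : depthE (parentE k) + 1 = depthE k := by
  grind [depthE, parentE]

theorem parentE_inj {k l : ℕ} (hk : k ≠ 3) (hl : l ≠ 3) (hpar : parentE k ≠ 3)
    (hkl : parentE k = parentE l) : k = l := by
  grind [parentE]

theorem parentE_eq_three_iff {k : ℕ} : parentE k = 3 ↔ k ∈ ({0, 2, 4} : Finset ℕ) := by
  grind [parentE]

theorem parentE_of_three_lt {k : ℕ} (hk : 3 < k) : parentE k = k - 1 := by
  rw [parentE, if_neg (by omega)]

theorem parentE_eq_or_of_adj {n : ℕ} {a b : Fin n} (hab : (coxeterGraphE n).Adj a b) :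
    (a : ℕ) ≠ 3 ∧ parentE a = b ∨ (b : ℕ) ≠ 3 ∧ parentE b = a := by
  rw [coxeterGraphE, SimpleGraph.fromRel_adj] at hab
  grind [parentE]

/-- The map `φ` embeds the subgraph of the Coxeter graph induced on `C` into a graph of
type `E`. -/
structure IsLabelling (M : CoxeterMatrix B) (C : Set B) (φ : B → ℕ) : Prop where
  injOn : Set.InjOn φ C
  adj : ∀ i ∈ C, ∀ j ∈ C, M i j = 3 →
    φ i ≠ 3 ∧ parentE (φ i) = φ j ∨ φ j ≠ 3 ∧ parentE (φ j) = φ i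

/-- The number of letters of `x` with the label `k`. -/
def labCount (φ : B → ℕ) (k : ℕ) (x : List B) : ℕ := (x.map φ).count k

section labCount

variable {φ : B → ℕ}

theorem labCount_append (k : ℕ) (x y : List B) :
    labCount φ k (x ++ y) = labCount φ k x + labCount φ k y := by
  simp [labCount]

theorem labCount_cons_of_eq {k : ℕ} {j : B} (hj : φ j = k) (x : List B) :
    labCount φ k (j :: x) = labCount φ k x + 1 := by
  simp [labCount, hj]

theorem labCount_cons_of_ne {k : ℕ} {j : B} (hj : φ j ≠ k) (x : List B) :
    labCount φ k (j :: x) = labCount φ k x := by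
  simp [labCount, hj]

theorem labCount_eq_zero_iff {k : ℕ} {x : List B} :
    labCount φ k x = 0 ↔ ∀ j ∈ x, φ j ≠ k := by
  simp [labCount, List.count_eq_zero]

theorem labCount_pos_iff {k : ℕ} {x : List B} : 0 < labCount φ k x ↔ ∃ j ∈ x, φ j = k := by
  simp [labCount, List.count_pos_iff]

theorem labCount_reverse (k : ℕ) (x : List B) : labCount φ k x.reverse = labCount φ k x := by
  simp [labCount]

theorem labCount_le_of_sublist (k : ℕ) {x y : List B} (hxy : x.Sublist y) :
    labCount φ k x ≤ labCount φ k y :=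
  (hxy.map φ).count_le k

theorem sum_labCount {s : Finset ℕ} {x : List B} (hx : ∀ j ∈ x, φ j ∈ s) :
    ∑ k ∈ s, labCount φ k x = x.length := by
  simpa [labCount] using
    Multiset.sum_count_eq_card (s := s) (m := (x.map φ : Multiset ℕ)) (by simpa using hx)

theorem nbCount_le_sum_labCount {i : B} {s : Finset ℕ} {x : List B}
    (hx : ∀ j ∈ x, M i j = 3 → φ j ∈ s) : nbCount M i x ≤ ∑ k ∈ s, labCount φ k x := by
  have hfilter : ∀ j ∈ x.filter fun j => M i j = 3, φ j ∈ s := fun j hj => by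
    rw [List.mem_filter, decide_eq_true_eq] at hj
    exact hx j hj.1 hj.2
  rw [nbCount, List.countP_eq_length_filter, ← sum_labCount hfilter]
  exact Finset.sum_le_sum fun k _ => labCount_le_of_sublist k List.filter_sublist

theorem exists_first_of_labCount_pos {k : ℕ} {x : List B} (hx : 0 < labCount φ k x) :
    ∃ y i z, x = y ++ i :: z ∧ φ i = k ∧ labCount φ k y = 0 := by
  induction x with
  | nil => simp [labCount] at hx
  | cons j x ih =>
    by_cases hj : φ j = k
    · exact ⟨[], j, x, rfl, hj, rfl⟩
    · obtain ⟨y, i, z, rfl, hi, hy⟩ := ih (by rwa [labCount_cons_of_ne hj] at hx)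
      exact ⟨j :: y, i, z, rfl, hi, by rwa [labCount_cons_of_ne hj]⟩

theorem exists_last_of_labCount_pos {k : ℕ} {x : List B} (hx : 0 < labCount φ k x) :
    ∃ y i z, x = y ++ i :: z ∧ φ i = k ∧ labCount φ k z = 0 := by
  obtain ⟨y, i, z, hxy, hi, hy⟩ := exists_first_of_labCount_pos (labCount_reverse k x ▸ hx)
  exact ⟨z.reverse, i, y.reverse, by simpa using congrArg List.reverse hxy, hi,
    by rwa [labCount_reverse]⟩

theorem exists_ends_of_two_le_labCount {k : ℕ} {x : List B} (hx : 2 ≤ labCount φ k x) :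
    ∃ u i y j v, x = u ++ i :: y ++ j :: v ∧ φ i = k ∧ φ j = k ∧ labCount φ k u = 0 ∧
      labCount φ k v = 0 := by
  obtain ⟨u, i, z, rfl, hi, hu⟩ := exists_first_of_labCount_pos (by omega : 0 < labCount φ k x)
  rw [labCount_append, labCount_cons_of_eq hi] at hx
  obtain ⟨y, j, v, rfl, hj, hv⟩ := exists_last_of_labCount_pos (by omega : 0 < labCount φ k z)
  exact ⟨u, i, y, j, v, by simp, hi, hj, hu, hv⟩

theorem length_le_of_labCount {S : List B → Prop} (hS : ∀ u x v, S (u ++ x ++ v) → S x) {k K : ℕ}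
    (hK : ∀ x, S x → labCount φ k x = 0 → x.length ≤ K) {x : List B} (hx : S x) :
    x.length ≤ (labCount φ k x + 1) * (K + 1) := by
  induction hn : labCount φ k x generalizing x with
  | zero => have := hK x hx hn; omega
  | succ n ih =>
    obtain ⟨y, i, z, rfl, hi, hy⟩ := exists_first_of_labCount_pos (by omega : 0 < labCount φ k x)
    rw [labCount_append, labCount_cons_of_eq hi, hy] at hn
    have hfirst := hK y (hS [] y (i :: z) (by simpa using hx)) hy
    have hrest := ih (hS (y ++ [i]) z [] (by simpa using hx)) (by omega)
    rw [List.length_append, List.length_cons]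
    linarith

end labCount

namespace IsLabelling

variable {C : Set B} {φ : B → ℕ} (hφ : IsLabelling M C φ)
include hφ

theorem exists_gap {k : ℕ} {x : List B} (hxC : ∀ j ∈ x, j ∈ C) (hx : 2 ≤ labCount φ k x) :
    ∃ x₁ i x₂ x₃, x = x₁ ++ i :: x₂ ++ i :: x₃ ∧ φ i = k ∧ labCount φ k x₁ = 0 ∧
      labCount φ k x₂ = 0 := by
  obtain ⟨x₁, i, y, rfl, hi, hx₁⟩ := exists_first_of_labCount_pos (by omega : 0 < labCount φ k x)
  rw [labCount_append, labCount_cons_of_eq hi] at hx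
  obtain ⟨x₂, j, x₃, rfl, hj, hx₂⟩ := exists_first_of_labCount_pos (by omega : 0 < labCount φ k y)
  obtain rfl : j = i := hφ.injOn (hxC j (by simp)) (hxC i (by simp)) (hj.trans hi.symm)
  exact ⟨x₁, j, x₂, x₃, by simp, hi, hx₁, hx₂⟩

theorem nbCount_le_of_label_three {b : B} {x : List B} (hbC : b ∈ C) (hxC : ∀ j ∈ x, j ∈ C)
    (hb : φ b = 3) :
    nbCount M b x ≤ labCount φ 0 x + labCount φ 2 x + labCount φ 4 x := by
  have hle := nbCount_le_sum_labCount (M := M) (φ := φ) (s := {0, 2, 4}) (x := x) fun j hj hbj =>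
    parentE_eq_three_iff.1
      (hb ▸ (((hφ.adj b hbC j (hxC j hj) hbj).resolve_left fun hadj => hadj.1 hb).2))
  simpa [add_assoc] using hle

theorem nbCount_le_of_label_two {i : B} {x : List B} (hiC : i ∈ C) (hxC : ∀ j ∈ x, j ∈ C)
    (hi : φ i = 2) : nbCount M i x ≤ labCount φ 1 x + labCount φ 3 x := by
  have hle := nbCount_le_sum_labCount (M := M) (φ := φ) (s := {1, 3}) (x := x) fun j hj hij => by
    have hadj := hφ.adj i hiC j (hxC j hj) hij
    grind [parentE]
  simpa using hle

theorem nbCount_le_of_three_lt_label {i : B} {k : ℕ} {x : List B} (hiC : i ∈ C)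
    (hxC : ∀ j ∈ x, j ∈ C) (hk : 3 ≤ k) (hi : φ i = k + 1) :
    nbCount M i x ≤ labCount φ k x + labCount φ (k + 2) x := by
  have hle := nbCount_le_sum_labCount (M := M) (φ := φ) (s := {k, k + 2}) (x := x)
    fun j hj hij => by
      have hadj := hφ.adj i hiC j (hxC j hj) hij
      grind [parentE]
  simpa using hle

theorem nbCount_eq_zero_of_label_zero {i : B} {x : List B} (hiC : i ∈ C) (hxC : ∀ j ∈ x, j ∈ C)
    (hi : φ i = 0) (hx : labCount φ 3 x = 0) : nbCount M i x = 0 := by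
  have hle := nbCount_le_sum_labCount (M := M) (φ := φ) (s := {3}) (x := x) fun j hj hij => by
    have hadj := hφ.adj i hiC j (hxC j hj) hij
    grind [parentE]
  simpa [hx] using hle

theorem nbCount_eq_zero_of_label_one {i : B} {x : List B} (hiC : i ∈ C) (hxC : ∀ j ∈ x, j ∈ C)
    (hi : φ i = 1) (hx : labCount φ 2 x = 0) : nbCount M i x = 0 := by
  have hle := nbCount_le_sum_labCount (M := M) (φ := φ) (s := {2}) (x := x) fun j hj hij => by
    have hadj := hφ.adj i hiC j (hxC j hj) hij
    grind [parentE]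
  simpa [hx] using hle

theorem exists_label_one {i : B} {x : List B} (hiC : i ∈ C) (hxC : ∀ j ∈ x, j ∈ C)
    (hi : φ i = 2) (hx : labCount φ 3 x = 0) (hnb : 0 < nbCount M i x) :
    ∃ j ∈ x, φ j = 1 ∧ M j i = 3 := by
  obtain ⟨x₁, j, x₂, rfl, hij⟩ := exists_eq_append_of_nbCount_pos hnb
  have hle := hφ.nbCount_le_of_label_two (x := [j]) hiC (by simpa using hxC j (by simp)) hi
  have hj3 : φ j ≠ 3 := labCount_eq_zero_iff.1 hx j (by simp)
  rw [nbCount_cons_of_eq_three hij, labCount_cons_of_ne hj3, show labCount φ 3 [] = 0 from rfl]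
    at hle
  obtain ⟨k, hk, hk1⟩ := labCount_pos_iff.1 (by omega : 0 < labCount φ 1 [j])
  exact ⟨j, by simp, List.mem_singleton.1 hk ▸ hk1, M.symmetric i j ▸ hij⟩

end IsLabelling

end Labelling

/-! ### Normal factors -/

section NormalFactor

variable {B W : Type*} [Group W] {M : CoxeterMatrix B}

/-- A factor of a reduced expression of a maximally clustered element, with letters in `C`, whose
letters are, in total, as far from the branch vertex as possible. -/
structure IsNormalFactor (cs : CoxeterSystem M W) (h : M.IsSimplyLaced) (C : Set B) (φ : B → ℕ)
    (ω : List B) : Prop where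
  isClusterFactor : IsClusterFactor cs h ω
  mem : ∀ i ∈ ω, i ∈ C
  max : ∀ ω', WordEquiv cs ω ω' →
    (ω'.map fun i => depthE (φ i)).sum ≤ (ω.map fun i => depthE (φ i)).sum

variable {cs : CoxeterSystem M W} {h : M.IsSimplyLaced} {C : Set B} {φ : B → ℕ}

theorem IsClusterFactor.three_le_nbCount {i j : B} {x y : List B}
    (hω : IsClusterFactor cs h (j :: x ++ j :: y ++ [j])) (hij : M i j = 3) (hjx : j ∉ x)
    (hjy : j ∉ y) (hix : i ∈ x) (hiy : i ∈ y) (hx : nbCount M i x = 0) (hy : nbCount M i y = 0) :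
    3 ≤ nbCount M j x ∧ 3 ≤ nbCount M j y := by
  obtain ⟨x₁, x₂, rfl⟩ := List.append_of_mem hix
  obtain ⟨y₁, y₂, rfl⟩ := List.append_of_mem hiy
  simp only [List.mem_append, List.mem_cons, not_or] at hjx hjy
  rw [nbCount_append, Nat.add_eq_zero_iff, nbCount_cons_eq_zero_iff] at hx hy
  exact ⟨not_gap_left hij (factor (u := []) (v := y₂ ++ [j]) (by simpa using hω)) hjx.1 hjx.2.2
      hx.2.2 hy.1,
    not_gap_right hij (factor (u := j :: x₁) (v := []) (by simpa using hω)) hjy.2.2 hjy.1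
      hy.1 hx.2.2⟩

namespace IsNormalFactor

theorem factor {u ω v : List B} (hω : IsNormalFactor cs h C φ (u ++ ω ++ v)) :
    IsNormalFactor cs h C φ ω where
  isClusterFactor := hω.isClusterFactor.factor
  mem i hi := hω.mem i (by simp [hi])
  max ω' e := by
    have hmax := hω.max _ (e.append u v)
    simp only [List.map_append, List.sum_append] at hmax
    omega

theorem of_gap {i : B} {x : List B} (hω : IsNormalFactor cs h C φ (i :: x ++ [i])) :
    IsNormalFactor cs h C φ x := factor (u := [i]) (v := [i]) hω

theorem depthE_le {i j : B} {x y : List B}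
    (hω : IsNormalFactor cs h C φ (i :: (x ++ j :: y) ++ [i])) (hij : M i j = 3)
    (hx : nbCount M i (x ++ j :: y) = 1) : depthE (φ j) ≤ depthE (φ i) := by
  rw [nbCount_append, nbCount_cons_of_eq_three hij] at hx
  have hmax := hω.max _ (wordEquiv_gap_braid cs h hij (by omega) (by omega))
  simp only [List.map_append, List.map_cons, List.map_nil, List.sum_append, List.sum_cons,
    List.sum_nil] at hmax
  omega

theorem two_le_nbCount (hφ : IsLabelling M C φ) {b : B} {x : List B}
    (hω : IsNormalFactor cs h C φ (b :: x ++ [b])) (hb : φ b = 3) : 2 ≤ nbCount M b x := by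
  have hpos := hω.isClusterFactor.nbCount_pos
  by_contra hone
  obtain ⟨x₁, j, x₂, rfl, hbj⟩ := exists_eq_append_of_nbCount_pos hpos
  have hdepth := hω.depthE_le hbj (by omega)
  obtain ⟨hj, -⟩ := (hφ.adj b (hω.mem b (by simp)) j (hω.mem j (by simp)) hbj).resolve_left
    fun hadj => hadj.1 hb
  have hsucc := depthE_parentE_add_one hj
  have hzero : depthE (φ b) = 0 := by rw [hb]; rfl
  omega

theorem exists_parent (hφ : IsLabelling M C φ) {i : B} {x : List B}
    (hω : IsNormalFactor cs h C φ (i :: x ++ [i])) (hix : i ∉ x) (hi : φ i ≠ 3) :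
    ∃ j ∈ x, φ j = parentE (φ i) := by
  induction hn : x.length using Nat.strong_induction_on generalizing x i with
  | _ n ih =>
  subst hn
  by_contra! hno
  have hiC := hω.mem i (by simp)
  have hxC : ∀ j ∈ x, j ∈ C := fun j hj => hω.mem j (by simp [hj])
  have hchild : ∀ j ∈ x, M i j = 3 → φ j ≠ 3 ∧ parentE (φ j) = φ i := fun j hj hij =>
    (hφ.adj i hiC j (hxC j hj) hij).resolve_left fun hadj => hno j hj hadj.2.symm
  have hpos := hω.isClusterFactor.nbCount_pos
  obtain ⟨x₁, j, x₂, hx, hij⟩ := exists_eq_append_of_nbCount_pos hpos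
  obtain ⟨hj, hparent⟩ := hchild j (by simp [hx]) hij
  have hne : nbCount M i x ≠ 1 := by
    rintro hone
    subst hx
    have hdepth := hω.depthE_le hij hone
    have hsucc := depthE_parentE_add_one hj
    rw [hparent] at hsucc
    omega
  have hle : nbCount M i x ≤ labCount φ (φ j) x := by
    simpa using nbCount_le_sum_labCount (M := M) (φ := φ) (s := {φ j}) fun k hk hik => by
      obtain ⟨hk3, hkparent⟩ := hchild k hk hik
      exact Finset.mem_singleton.2
        (parentE_inj hk3 hj (hkparent ▸ hi) (hkparent.trans hparent.symm))
  obtain ⟨y₁, a, y₂, y₃, rfl, ha, -, hy₂⟩ := hφ.exists_gap hxC (by omega : 2 ≤ labCount φ (φ j) x)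
  obtain ⟨c, hc, hcparent⟩ := ih y₂.length (by simp; omega) (i := a) (x := y₂)
    (factor (u := i :: y₁) (v := y₃ ++ [i]) (by simpa using hω))
    (fun hmem => labCount_eq_zero_iff.1 hy₂ a hmem ha) (ha ▸ hj) rfl
  rw [ha, hparent] at hcparent
  obtain rfl := hφ.injOn (hxC c (by simp [hc])) hiC hcparent
  exact hix (by simp [hc])

theorem labCount_le_parent (hφ : IsLabelling M C φ) {ω : List B}
    (hω : IsNormalFactor cs h C φ ω) {k l : ℕ} (hk : k ≠ 3) (hl : parentE k = l) :
    labCount φ k ω ≤ labCount φ l ω + 1 := by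
  induction hn : ω.length using Nat.strong_induction_on generalizing ω with
  | _ n ih =>
  subst hn
  by_contra hlt
  obtain ⟨x₁, i, x₂, x₃, rfl, hi, hx₁, hx₂⟩ :=
    hφ.exists_gap hω.mem (by omega : 2 ≤ labCount φ k ω)
  have hpos : 0 < labCount φ l x₂ := by
    rw [labCount_pos_iff, ← hl, ← hi]
    exact exists_parent hφ (factor (u := x₁) (v := x₃) (by simpa using hω))
      (fun hmem => labCount_eq_zero_iff.1 hx₂ i hmem hi) (hi ▸ hk)
  have htail := ih (i :: x₃).length (by simp; omega)
    (factor (u := x₁ ++ i :: x₂) (v := []) (by simpa using hω)) rfl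
  have hcons := labCount_le_of_sublist (φ := φ) l (List.sublist_cons_self i x₂)
  simp only [labCount_append, labCount_cons_of_eq hi, hx₁, hx₂] at hlt htail
  omega

theorem labCount_le_one_of_gap (hφ : IsLabelling M C φ) {x : List B}
    (hx : IsNormalFactor cs h C φ x) (hx3 : labCount φ 3 x = 0) {k : ℕ} (hk : parentE k = 3) :
    labCount φ k x ≤ 1 := by
  have hk3 : k ≠ 3 := by rintro rfl; simp [parentE] at hk
  simpa [hx3] using hx.labCount_le_parent hφ hk3 hk

theorem exists_adj_of_gap (hφ : IsLabelling M C φ) {b : B} {x : List B}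
    (hω : IsNormalFactor cs h C φ (b :: x ++ [b])) (hb : φ b = 3) (hx3 : labCount φ 3 x = 0)
    {k l m : ℕ} (hklm : ({0, 2, 4} : Finset ℕ) = {k, l, m}) (hm : labCount φ m x = 0) :
    ∃ i ∈ x, φ i = k ∧ M i b = 3 := by
  by_contra! hno
  have hx := hω.of_gap
  have hle : nbCount M b x ≤ ∑ k ∈ {l}, labCount φ k x :=
    nbCount_le_sum_labCount fun j hj hbj => by
      have hparent := ((hφ.adj b (hω.mem b (by simp)) j (hx.mem j hj) hbj).resolve_left
        fun hadj => hadj.1 hb).2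
      have hmem := parentE_eq_three_iff.1 (hparent.trans hb)
      rw [hklm] at hmem
      simp only [Finset.mem_insert, Finset.mem_singleton] at hmem ⊢
      rcases hmem with hk | hl | hm'
      · exact absurd (M.symmetric b j ▸ hbj) (hno j hj hk)
      · exact hl
      · exact absurd hm' (labCount_eq_zero_iff.1 hm j hj)
  have hl : parentE l = 3 := parentE_eq_three_iff.2 (by simp [hklm])
  have htwo := hω.two_le_nbCount hφ hb
  have hone := hx.labCount_le_one_of_gap hφ hx3 hl
  rw [Finset.sum_singleton] at hle
  omega

theorem mem_of_label_two_of_gap (hφ : IsLabelling M C φ) {b i o : B} {x : List B}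
    (hω : IsNormalFactor cs h C φ (b :: x ++ [b])) (hb : φ b = 3) (hx3 : labCount φ 3 x = 0)
    (hoC : o ∈ C) (ho : φ o = 0) (hiC : i ∈ C) (hi : φ i = 2) (hox : o ∉ x) : i ∈ x := by
  have hxC := hω.of_gap.mem
  have hx0 : labCount φ 0 x = 0 := labCount_eq_zero_iff.2 fun j hj hj0 =>
    hox (hφ.injOn (hxC j hj) hoC (hj0.trans ho.symm) ▸ hj)
  obtain ⟨j, hj, hj2, -⟩ :=
    hω.exists_adj_of_gap hφ hb hx3 (k := 2) (l := 4) (m := 0) (by decide) hx0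
  exact hφ.injOn (hxC j hj) hiC (hj2.trans hi.symm) ▸ hj

theorem nbCount_le_two_of_gap (hφ : IsLabelling M C φ) {b : B} {x : List B} (hbC : b ∈ C)
    (hx : IsNormalFactor cs h C φ x) (hb : φ b = 3) (hx3 : labCount φ 3 x = 0)
    (hx4 : labCount φ 4 x = 0) : nbCount M b x ≤ 2 := by
  have hle := hφ.nbCount_le_of_label_three hbC hx.mem hb
  have hzero := hx.labCount_le_one_of_gap hφ hx3 (k := 0) rfl
  have htwo := hx.labCount_le_one_of_gap hφ hx3 (k := 2) rfl
  omega

theorem three_le_nbCount_of_label_two (hφ : IsLabelling M C φ) {b i : B} {p q r s : List B}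
    (hω : IsNormalFactor cs h C φ (i :: (p ++ b :: q) ++ i :: (r ++ b :: s) ++ [i]))
    (hb : φ b = 3) (hi : φ i = 2) (hib : M i b = 3)
    (hleft : labCount φ 2 (p ++ b :: q) = 0) (hright : labCount φ 2 (r ++ b :: s) = 0)
    (hpq : labCount φ 3 (p ++ q) = 0) (hrs : labCount φ 3 (r ++ s) = 0) :
    3 ≤ nbCount M b (q ++ i :: r) := by
  by_contra hlt
  have hiC := hω.mem i (by simp)
  have hpqC : ∀ j ∈ p ++ q, j ∈ C := fun j hj => hω.mem j (by grind)
  have hrsC : ∀ j ∈ r ++ s, j ∈ C := fun j hj => hω.mem j (by grind)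
  have hbpq : b ∉ p ++ q := fun hmem => labCount_eq_zero_iff.1 hpq b hmem hb
  have hbrs : b ∉ r ++ s := fun hmem => labCount_eq_zero_iff.1 hrs b hmem hb
  have hnbpq : nbCount M i (p ++ q) ≠ 0 := fun hzero => by
    rw [nbCount_append] at hzero
    exact hlt (IsClusterFactor.not_gap_right hib (.factor (u := []) (v := s ++ [i])
      (by simpa using hω.isClusterFactor)) (by grind) (by grind) (by omega) (by omega))
  have hnbrs : nbCount M i (r ++ s) ≠ 0 := fun hzero => by
    rw [nbCount_append] at hzero
    exact hlt (IsClusterFactor.not_gap_left hib (.factor (u := i :: p) (v := [])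
      (by simpa using hω.isClusterFactor)) (by grind) (by grind) (by omega) (by omega))
  obtain ⟨e, he, he1, hei⟩ := hφ.exists_label_one hiC hpqC hi hpq (by omega)
  obtain ⟨e', he', he1', -⟩ := hφ.exists_label_one hiC hrsC hi hrs (by omega)
  obtain rfl := hφ.injOn (hrsC e' he') (hpqC e he) (he1'.trans he1.symm)
  have hleftN : IsNormalFactor cs h C φ (p ++ b :: q) :=
    factor (u := [i]) (v := i :: (r ++ b :: s) ++ [i]) (by simpa using hω)
  have hrightN : IsNormalFactor cs h C φ (r ++ b :: s) :=
    factor (u := i :: (p ++ b :: q) ++ [i]) (v := [i]) (by simpa using hω)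
  have hthree := (hω.isClusterFactor.three_le_nbCount hei
    (fun hmem => labCount_eq_zero_iff.1 hleft i hmem hi)
    (fun hmem => labCount_eq_zero_iff.1 hright i hmem hi) (by grind)
    (by grind)
    (hφ.nbCount_eq_zero_of_label_one (hpqC e' he) hleftN.mem he1 hleft)
    (hφ.nbCount_eq_zero_of_label_one (hpqC e' he) hrightN.mem he1 hright)).1
  have hle := hφ.nbCount_le_of_label_two hiC hleftN.mem hi
  have hone := hleftN.labCount_le_parent hφ (k := 1) (by decide) rfl
  rw [labCount_append] at hpq
  rw [show parentE 1 = 2 from rfl, hleft] at hone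
  rw [labCount_append 3, labCount_cons_of_eq hb] at hle
  omega

theorem three_le_nbCount_of_mem_gaps (hφ : IsLabelling M C φ) {b i : B} {x y z : List B}
    (hω : IsNormalFactor cs h C φ (b :: x ++ b :: y ++ b :: z ++ [b])) (hb : φ b = 3)
    (hi : φ i = 2) (hib : M i b = 3) (hx3 : labCount φ 3 x = 0) (hy3 : labCount φ 3 y = 0)
    (hz3 : labCount φ 3 z = 0) (hix : i ∈ x) (hiy : i ∈ y) (hiz : i ∈ z) :
    3 ≤ nbCount M b y := by
  have hx := (factor (u := [b]) (v := b :: y ++ b :: z ++ [b]) (by simpa using hω) :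
    IsNormalFactor cs h C φ x).labCount_le_one_of_gap hφ hx3 (k := 2) rfl
  have hy := (factor (u := b :: x ++ [b]) (v := b :: z ++ [b]) (by simpa using hω) :
    IsNormalFactor cs h C φ y).labCount_le_one_of_gap hφ hy3 (k := 2) rfl
  have hz := (factor (u := b :: x ++ b :: y ++ [b]) (v := [b]) (by simpa using hω) :
    IsNormalFactor cs h C φ z).labCount_le_one_of_gap hφ hz3 (k := 2) rfl
  obtain ⟨x₁, p, rfl⟩ := List.append_of_mem hix
  obtain ⟨q, r, rfl⟩ := List.append_of_mem hiy
  obtain ⟨s, z₂, rfl⟩ := List.append_of_mem hiz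
  have hi3 : φ i ≠ 3 := by omega
  have hb2 : φ b ≠ 2 := by omega
  simp only [labCount_append, labCount_cons_of_eq hi, labCount_cons_of_ne hi3]
    at hx hy hz hx3 hy3 hz3
  exact three_le_nbCount_of_label_two hφ
    (factor (u := b :: x₁) (v := z₂ ++ [b]) (by simpa using hω)) hb hi hib
    (by rw [labCount_append, labCount_cons_of_ne hb2]; omega)
    (by rw [labCount_append, labCount_cons_of_ne hb2]; omega)
    (by rw [labCount_append]; omega) (by rw [labCount_append]; omega)

-- The neighbours `0` and `2` of `b` both occur in a middle gap without `4`. Then `0` occurs in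
-- neither of the outer gaps, so that `2` occurs in all three.
theorem exists_label_four_of_gaps (hφ : IsLabelling M C φ) {b : B} {x y z : List B}
    (hω : IsNormalFactor cs h C φ (b :: x ++ b :: y ++ b :: z ++ [b])) (hb : φ b = 3)
    (hx3 : labCount φ 3 x = 0) (hy3 : labCount φ 3 y = 0) (hz3 : labCount φ 3 z = 0) :
    ∃ j ∈ y, φ j = 4 := by
  by_contra! hy4
  rw [← labCount_eq_zero_iff] at hy4
  have hbC : b ∈ C := hω.mem b (by simp)
  have hbnot : ∀ {v}, labCount φ 3 v = 0 → b ∉ v := fun hv hmem =>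
    labCount_eq_zero_iff.1 hv b hmem hb
  have hbx : IsNormalFactor cs h C φ (b :: x ++ [b]) :=
    factor (u := []) (v := y ++ b :: z ++ [b]) (by simpa using hω)
  have hby : IsNormalFactor cs h C φ (b :: y ++ [b]) :=
    factor (u := b :: x) (v := z ++ [b]) (by simpa using hω)
  have hbz : IsNormalFactor cs h C φ (b :: z ++ [b]) :=
    factor (u := b :: x ++ b :: y) (v := []) (by simpa using hω)
  have hbxy : IsClusterFactor cs h (b :: x ++ b :: y ++ [b]) :=
    .factor (u := []) (v := z ++ [b]) (by simpa using hω.isClusterFactor)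
  have hbyz : IsClusterFactor cs h (b :: y ++ b :: z ++ [b]) :=
    .factor (u := b :: x) (v := []) (by simpa using hω.isClusterFactor)
  have hy := hby.of_gap
  have htwo := hy.nbCount_le_two_of_gap hφ hbC hb hy3 hy4
  obtain ⟨o, hoy, ho, hob⟩ := hby.exists_adj_of_gap hφ hb hy3 (l := 2) (m := 4) rfl hy4
  obtain ⟨i, hiy, hi, hib⟩ := hby.exists_adj_of_gap hφ hb hy3 (k := 2) (l := 0) (m := 4)
    (by decide) hy4
  have hnb : ∀ {v}, IsNormalFactor cs h C φ (b :: v ++ [b]) → labCount φ 3 v = 0 →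
      nbCount M o v = 0 := fun hbv hv3 => hφ.nbCount_eq_zero_of_label_zero (hy.mem o hoy)
    hbv.of_gap.mem ho hv3
  have hix : i ∈ x := hbx.mem_of_label_two_of_gap hφ hb hx3 (hy.mem o hoy) ho
      (hy.mem i hiy) hi fun hox => by
    have := (hbxy.three_le_nbCount hob (hbnot hx3) (hbnot hy3) hox hoy (hnb hbx hx3)
      (hnb hby hy3)).2
    omega
  have hiz : i ∈ z := hbz.mem_of_label_two_of_gap hφ hb hz3 (hy.mem o hoy) ho
      (hy.mem i hiy) hi fun hoz => by
    have := (hbyz.three_le_nbCount hob (hbnot hy3) (hbnot hz3) hoy hoz (hnb hby hy3)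
      (hnb hbz hz3)).1
    omega
  exact absurd (three_le_nbCount_of_mem_gaps hφ hω hb hi hib hx3 hy3 hz3 hix hiy hiz) (by omega)

theorem exists_label_four (hφ : IsLabelling M C φ) {b : B} {u x v : List B}
    (hω : IsNormalFactor cs h C φ (u ++ b :: x ++ b :: v)) (hb : φ b = 3)
    (hu : 0 < labCount φ 3 u) (hx : labCount φ 3 x = 0) (hv : 0 < labCount φ 3 v) :
    ∃ j ∈ x, φ j = 4 := by
  obtain ⟨u₁, c, y, rfl, hc, hy⟩ := exists_last_of_labCount_pos hu
  obtain ⟨z, d, v₂, rfl, hd, hz⟩ := exists_first_of_labCount_pos hv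
  have hbC := hω.mem b (by simp)
  obtain rfl := hφ.injOn (hω.mem c (by simp)) hbC (hc.trans hb.symm)
  obtain rfl := hφ.injOn (hω.mem d (by simp)) hbC (hd.trans hb.symm)
  exact exists_label_four_of_gaps hφ (factor (u := u₁) (v := v₂) (by simpa using hω)) hb hy hx hz

end IsNormalFactor

end NormalFactor

/-! ### Normal factors have bounded length -/

section BoundedLength

variable {B W : Type*} [Group W] {M : CoxeterMatrix B}

/-- The word `x`, thought of as the gap between two occurrences of `i`, can be rewritten so as to
contain a single neighbour of `i`. -/
def IsShortenable (cs : CoxeterSystem M W) (i : B) (x : List B) : Prop :=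
  ∃ x', WordEquiv cs x x' ∧ nbCount M i x' = 1

variable {cs : CoxeterSystem M W} {h : M.IsSimplyLaced} {C : Set B} {φ : B → ℕ}

theorem IsClusterFactor.not_isShortenable {i : B} {x y : List B}
    (hω : IsClusterFactor cs h (i :: x ++ i :: y ++ [i])) (hix : i ∉ x) (hiy : i ∉ y)
    (hx : IsShortenable cs i x) : ¬IsShortenable cs i y := by
  rintro ⟨y', ey, hy'⟩
  obtain ⟨x', ex, hx'⟩ := hx
  have e := (ex.append [i] (i :: y ++ [i])).trans
    (by simpa using ey.append (i :: x' ++ [i]) [i])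
  exact not_two_gaps (hω.of_wordEquiv (by simpa using e)) (by rwa [← ex.mem_iff])
    (by rwa [← ey.mem_iff]) hx' hy'

theorem IsLabelling.labCount_le_two (hφ : IsLabelling M C φ) {k : ℕ} {x : List B}
    (hω : IsClusterFactor cs h x) (hxC : ∀ j ∈ x, j ∈ C)
    (hgap : ∀ p i y q, x = p ++ i :: y ++ i :: q → φ i = k → labCount φ k y = 0 →
      IsShortenable cs i y) : labCount φ k x ≤ 2 := by
  by_contra! hlt
  obtain ⟨p, i, y, q, rfl, hi, hp, hy⟩ := hφ.exists_gap hxC hlt.le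
  simp only [labCount_append, labCount_cons_of_eq hi, hp, hy] at hlt
  obtain ⟨z, j, q', rfl, hj, hz⟩ := exists_first_of_labCount_pos (by omega : 0 < labCount φ k q)
  obtain rfl := hφ.injOn (hxC j (by simp)) (hxC i (by simp)) (hj.trans hi.symm)
  have hgaps : IsClusterFactor cs h (j :: y ++ j :: z ++ [j]) :=
    .factor (u := p) (v := q') (by simpa using hω)
  exact hgaps.not_isShortenable (fun hmem => labCount_eq_zero_iff.1 hy j hmem hj)
    (fun hmem => labCount_eq_zero_iff.1 hz j hmem hj) (hgap p j y _ rfl hj hy)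
    (hgap (p ++ j :: y) j z q' (by simp) hj hz)

theorem IsShortenable.exists_labCount_eq_one (h : M.IsSimplyLaced) {k : ℕ} {i : B}
    {p x q : List B} (hx : IsShortenable cs i x) (hi : φ i = k) (hp : labCount φ k p = 0)
    (hxk : labCount φ k x = 0) (hq : labCount φ k q = 0) :
    ∃ ω, WordEquiv cs (p ++ i :: x ++ i :: q) ω ∧ labCount φ k ω = 1 := by
  obtain ⟨x', ex, hx'⟩ := hx
  obtain ⟨y, j, z, rfl, hij, hy, hz⟩ := exists_eq_append_of_nbCount_eq_one hx'
  have hyjz : labCount φ k (y ++ j :: z) = 0 :=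
    labCount_eq_zero_iff.2 fun l hl => labCount_eq_zero_iff.1 hxk l ((ex.mem_iff l).2 hl)
  have hj : φ j ≠ k := labCount_eq_zero_iff.1 hyjz j (by simp)
  have e := (ex.append (p ++ [i]) (i :: q)).trans
    (by simpa using (wordEquiv_gap_braid cs h hij hy hz).append p q)
  refine ⟨_, by simpa using e, ?_⟩
  simp only [labCount_append, labCount_cons_of_ne hj] at hyjz
  simp only [labCount_append, labCount_cons_of_eq hi, labCount_cons_of_ne hj, hp, hq]
  omega

theorem IsClusterFactor.isShortenable_of_labCount_le_one (hφ : IsLabelling M C φ) {k : ℕ}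
    (hk : 3 ≤ k) {i : B} {x x' : List B} (hω : IsClusterFactor cs h (i :: x ++ [i]))
    (hC : ∀ j ∈ i :: x, j ∈ C) (hi : φ i = k + 1) (hx : labCount φ (k + 2) x = 0)
    (e : WordEquiv cs x x') (hx' : labCount φ k x' ≤ 1) : IsShortenable cs i x := by
  have hpos : 0 < nbCount M i x' := (hω.of_wordEquiv (e.append [i] [i])).nbCount_pos
  have hle := hφ.nbCount_le_of_three_lt_label (hC i (by simp))
    (fun j hj => hC j (by simp [(e.mem_iff j).2 hj])) hk hi (x := x')
  have hzero : labCount φ (k + 2) x' = 0 :=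
    labCount_eq_zero_iff.2 fun j hj => labCount_eq_zero_iff.1 hx j ((e.mem_iff j).2 hj)
  exact ⟨x', e, by omega⟩

namespace IsNormalFactor

theorem labCount_three_le_one (hφ : IsLabelling M C φ) {u x v : List B}
    (hω : IsNormalFactor cs h C φ (u ++ x ++ v)) (hu : 0 < labCount φ 3 u)
    (hv : 0 < labCount φ 3 v) (hx : labCount φ 4 x = 0) : labCount φ 3 x ≤ 1 := by
  by_contra! hlt
  obtain ⟨p, b, y, q, rfl, hb, -, hy⟩ := hφ.exists_gap (fun j hj => hω.mem j (by simp [hj])) hlt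
  obtain ⟨j, hj, hj4⟩ := exists_label_four hφ (u := u ++ p) (v := q ++ v) (by simpa using hω) hb
    (by rw [labCount_append]; omega) hy (by rw [labCount_append]; omega)
  exact labCount_eq_zero_iff.1 hx j (by simp [hj]) hj4

-- The induction moves outwards along the long arm. A gap of `k + 2` holds at most two `k + 1`,
-- since by induction the gaps of `k + 1` in it are shortenable. If it holds two, then a braid move
-- on them leaves only one.
theorem isShortenable (hφ : IsLabelling M C φ) {k : ℕ} (hk : 3 ≤ k) {u x v : List B} {i : B}
    (hω : IsNormalFactor cs h C φ (u ++ i :: x ++ i :: v)) (hi : φ i = k + 1)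
    (hu : 0 < labCount φ 3 u) (hv : 0 < labCount φ 3 v) (hx : labCount φ (k + 1) x = 0)
    (hx' : labCount φ (k + 2) x = 0) : IsShortenable cs i x := by
  have hi3 : φ i ≠ 3 := by omega
  induction k, hk using Nat.le_induction generalizing u x v i with
  | base =>
    have hgap : IsNormalFactor cs h C φ (i :: x ++ [i]) :=
      factor (u := u) (v := v) (by simpa using hω)
    refine hgap.isClusterFactor.isShortenable_of_labCount_le_one hφ le_rfl
      (fun j hj => hgap.mem j (List.mem_append_left _ hj)) hi hx' (.refl x) ?_
    exact labCount_three_le_one hφ (u := u ++ [i]) (v := i :: v) (by simpa using hω)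
      (by rw [labCount_append]; omega) (by rwa [labCount_cons_of_ne hi3]) hx
  | succ k hk ih =>
    have hgap : IsNormalFactor cs h C φ (i :: x ++ [i]) :=
      factor (u := u) (v := v) (by simpa using hω)
    have hxN := hgap.of_gap
    have hinner : ∀ p a y q, x = p ++ a :: y ++ a :: q → φ a = k + 1 →
        labCount φ (k + 1) y = 0 → IsShortenable cs a y := by
      rintro p a y q rfl ha hy
      simp only [labCount_append, Nat.add_eq_zero_iff] at hx
      refine ih (u := u ++ i :: p) (v := q ++ i :: v) (by simpa using hω) ha
        (by rw [labCount_append]; omega)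
        (by rw [labCount_append, labCount_cons_of_ne hi3]; omega) hy ?_ (by omega)
      exact (labCount_cons_of_ne (by omega) y).symm.trans hx.1.2
    have htwo := hφ.labCount_le_two hxN.isClusterFactor hxN.mem hinner
    obtain ⟨x', e, hone⟩ : ∃ x', WordEquiv cs x x' ∧ labCount φ (k + 1) x' ≤ 1 := by
      by_cases hle : labCount φ (k + 1) x ≤ 1
      · exact ⟨x, .refl x, hle⟩
      obtain ⟨p, a, y, q, rfl, ha, hp, hy⟩ := hφ.exists_gap hxN.mem (not_le.1 hle)
      simp only [labCount_append, labCount_cons_of_eq ha] at htwo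
      obtain ⟨x', e, hone⟩ :=
        (hinner p a y q rfl ha hy).exists_labCount_eq_one h (q := q) ha hp hy (by omega)
      exact ⟨x', e, hone.le⟩
    exact hgap.isClusterFactor.isShortenable_of_labCount_le_one hφ (by omega)
      (fun j hj => hgap.mem j (List.mem_append_left _ hj)) hi hx' e hone

theorem labCount_add_three_le (hφ : IsLabelling M C φ) {ω : List B}
    (hω : IsNormalFactor cs h C φ ω) (k : ℕ) :
    labCount φ (k + 3) ω ≤ labCount φ 3 ω + k := by
  induction k with
  | zero => simp
  | succ k ih =>
    have hstep := hω.labCount_le_parent hφ (k := k + 1 + 3) (by omega)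
      (parentE_of_three_lt (by omega))
    rw [show k + 1 + 3 - 1 = k + 3 by omega] at hstep
    omega

theorem labCount_last_le_two (hφ : IsLabelling M C φ) {k : ℕ} (hk : 3 ≤ k) {u x v : List B}
    (hω : IsNormalFactor cs h C φ (u ++ x ++ v)) (hu : 0 < labCount φ 3 u)
    (hv : 0 < labCount φ 3 v) (hx : ∀ j ∈ x, φ j ≤ k + 1) : labCount φ (k + 1) x ≤ 2 := by
  have hxN := hω.factor
  refine hφ.labCount_le_two hxN.isClusterFactor hxN.mem ?_
  rintro p i y q rfl hi hy
  refine isShortenable hφ hk (u := u ++ p) (v := q ++ v) (by simpa using hω) hi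
    (by rw [labCount_append]; omega) (by rw [labCount_append]; omega) hy ?_
  exact labCount_eq_zero_iff.2 fun j hj => (Nat.lt_succ_of_le (hx j (by simp [hj]))).ne

theorem labCount_last_le (hφ : IsLabelling M C φ) {k : ℕ} (hk : 3 ≤ k) {ω : List B}
    (hω : IsNormalFactor cs h C φ ω) (hle : ∀ j ∈ ω, φ j ≤ k + 1) :
    labCount φ (k + 1) ω ≤ 2 * k := by
  obtain ⟨m, rfl⟩ := Nat.exists_eq_add_of_le' hk
  rcases le_or_gt (labCount φ 3 ω) 1 with hone | htwo
  · have := hω.labCount_add_three_le hφ (m + 1)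
    rw [show m + 1 + 3 = m + 3 + 1 by omega] at this
    omega
  obtain ⟨u, b, x, c, v, rfl, hb, hc, hu, hv⟩ := exists_ends_of_two_le_labCount htwo
  have hleft := (factor (u := []) (v := b :: x ++ c :: v) (by simpa using hω) :
    IsNormalFactor cs h C φ u).labCount_add_three_le hφ (m + 1)
  have hright := (factor (u := u ++ b :: x ++ [c]) (v := []) (by simpa using hω) :
    IsNormalFactor cs h C φ v).labCount_add_three_le hφ (m + 1)
  have hmiddle := labCount_last_le_two hφ (k := m + 3) hk (u := u ++ [b]) (x := x) (v := c :: v)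
    (by simpa using hω) (by rw [labCount_append, labCount_cons_of_eq hb]; omega)
    (by rw [labCount_cons_of_eq hc]; omega) fun j hj => hle j (by simp [hj])
  rw [hu, show m + 1 + 3 = m + 3 + 1 by omega] at hleft
  rw [hv, show m + 1 + 3 = m + 3 + 1 by omega] at hright
  rw [labCount_append, labCount_append, labCount_cons_of_ne (by omega),
    labCount_cons_of_ne (by omega)]
  omega

theorem labCount_three_le_three (hφ : IsLabelling M C φ) {ω : List B}
    (hω : IsNormalFactor cs h C φ ω) (hω4 : labCount φ 4 ω = 0) : labCount φ 3 ω ≤ 3 := by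
  rcases le_or_gt (labCount φ 3 ω) 1 with hone | htwo
  · omega
  obtain ⟨u, b, x, c, v, rfl, hb, hc, hu, hv⟩ := exists_ends_of_two_le_labCount htwo
  simp only [labCount_append, labCount_cons_of_ne (show φ b ≠ 4 by omega)] at hω4
  have hmiddle := labCount_three_le_one hφ (u := u ++ [b]) (x := x) (v := c :: v)
    (by simpa using hω) (by rw [labCount_append, labCount_cons_of_eq hb]; omega)
    (by rw [labCount_cons_of_eq hc]; omega) (by omega)
  simp only [labCount_append, labCount_cons_of_eq hb, labCount_cons_of_eq hc, hu, hv]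
  omega

theorem length_le_sixteen (hφ : IsLabelling M C φ) {ω : List B}
    (hω : IsNormalFactor cs h C φ ω) (hle : ∀ j ∈ ω, φ j ≤ 3) : ω.length ≤ 16 := by
  have hthree := hω.labCount_three_le_three hφ
    (labCount_eq_zero_iff.2 fun j hj => (Nat.lt_succ_of_le (hle j hj)).ne)
  have hzero := hω.labCount_le_parent hφ (k := 0) (by decide) rfl
  have htwo := hω.labCount_le_parent hφ (k := 2) (by decide) rfl
  have hone := hω.labCount_le_parent hφ (k := 1) (by decide) rfl
  rw [show parentE 0 = 3 from rfl] at hzero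
  rw [show parentE 2 = 3 from rfl] at htwo
  rw [show parentE 1 = 2 from rfl] at hone
  rw [← sum_labCount (s := Finset.range 4) fun j hj => Finset.mem_range_succ_iff.2 (hle j hj)]
  simp only [Finset.sum_range_succ, Finset.sum_range_zero]
  omega

theorem exists_length_le (hφ : IsLabelling M C φ) {k : ℕ} (hk : 3 ≤ k) :
    ∃ K, ∀ ω, IsNormalFactor cs h C φ ω → (∀ j ∈ ω, φ j ≤ k) → ω.length ≤ K := by
  induction k, hk using Nat.le_induction with
  | base => exact ⟨16, fun _ hω hle => hω.length_le_sixteen hφ hle⟩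
  | succ k hk ih =>
    obtain ⟨K, hK⟩ := ih
    refine ⟨(2 * k + 1) * (K + 1), fun ω hω hle => ?_⟩
    calc ω.length ≤ (labCount φ (k + 1) ω + 1) * (K + 1) :=
          length_le_of_labCount (S := fun x => IsNormalFactor cs h C φ x ∧ ∀ j ∈ x, φ j ≤ k + 1)
            (fun u x v hx => ⟨hx.1.factor, fun j hj => hx.2 j (by simp [hj])⟩)
            (fun x hx hxk => hK x hx.1 fun j hj =>
              Nat.le_of_lt_succ ((hx.2 j hj).lt_of_ne (labCount_eq_zero_iff.1 hxk j hj)))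
            ⟨hω, hle⟩
      _ ≤ (2 * k + 1) * (K + 1) := by gcongr; exact hω.labCount_last_le hφ hk hle

end IsNormalFactor

theorem IsClusterFactor.exists_isNormalFactor {ω : List B} (hω : IsClusterFactor cs h ω)
    (hC : ∀ i ∈ ω, i ∈ C) : ∃ ω', WordEquiv cs ω ω' ∧ IsNormalFactor cs h C φ ω' := by
  let weight (x : List B) : ℕ := (x.map fun i => depthE (φ i)).sum
  have hbdd : BddAbove (weight '' {x | WordEquiv cs ω x}) := by
    refine ⟨ω.length * weight ω, ?_⟩
    rintro _ ⟨x, e, rfl⟩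
    rw [e.length_eq, ← List.length_map fun i => depthE (φ i), ← smul_eq_mul]
    refine List.sum_le_card_nsmul _ _ fun d hd => ?_
    obtain ⟨i, hi, rfl⟩ := List.mem_map.1 hd
    exact List.single_le_sum (fun _ _ => Nat.zero_le _) _
      (List.mem_map_of_mem ((e.mem_iff i).2 hi))
  obtain ⟨ω', e, hmax⟩ := Nat.sSup_mem ⟨_, Set.mem_image_of_mem weight (.refl ω)⟩ hbdd
  exact ⟨ω', e, hω.of_wordEquiv e, fun i hi => hC i ((e.mem_iff i).2 hi), fun x e' =>
    (le_csSup hbdd ⟨x, e.trans e', rfl⟩).trans_eq hmax.symm⟩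

end BoundedLength

/-! ### The equivalence -/

section Equivalence

variable {B W : Type*} [Group W] {M : CoxeterMatrix B} (cs : CoxeterSystem M W)
  (h : M.IsSimplyLaced)

theorem exists_isLabelling {s : Set B} {n : ℕ}
    (hs : (M.coxeterGraph.induce s).IsContained (coxeterGraphE n)) :
    ∃ φ, IsLabelling M s φ ∧ ∀ i ∈ s, φ i < n := by
  classical
  obtain ⟨f⟩ := hs
  have hφ : ∀ i (hi : i ∈ s), (if hi : i ∈ s then (f ⟨i, hi⟩ : ℕ) else 0) = f ⟨i, hi⟩ :=
    fun i hi => dif_pos hi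
  refine ⟨fun i => if hi : i ∈ s then f ⟨i, hi⟩ else 0, ⟨fun i hi j hj hij => ?_,
    fun i hi j hj hij => ?_⟩, fun i hi => (hφ i hi).trans_lt (f ⟨i, hi⟩).2⟩
  · rw [hφ i hi, hφ j hj] at hij
    exact congrArg Subtype.val (f.injective (Fin.ext hij))
  · have hadj : (M.coxeterGraph.induce s).Adj ⟨i, hi⟩ ⟨j, hj⟩ := ⟨ne_of_eq_three hij, hij⟩
    rw [hφ i hi, hφ j hj]
    exact parentE_eq_or_of_adj (f.toHom.map_adj hadj)

include h in
theorem wordEquiv_filter {P : B → Bool} (hP : ∀ i j, P i = false → P j = true → M i j ≠ 3)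
    (ω : List B) : WordEquiv cs ω (ω.filter P ++ ω.filter fun i => !P i) := by
  induction ω with
  | nil => exact .refl _
  | cons j ω ih =>
    have hcons : WordEquiv cs (j :: ω) (j :: (ω.filter P ++ ω.filter fun i => !P i)) := by
      simpa using ih.append [j] []
    by_cases hj : P j
    · simpa [hj] using hcons
    · have hmove := wordEquiv_cons_append cs h (i := j) (x := ω.filter P)
        (nbCount_eq_zero_iff.2 fun k hk => hP j k (by simpa using hj) (List.mem_filter.1 hk).2)
        (ω.filter fun i => !P i)
      simpa [hj] using hcons.trans hmove

theorem exists_length_le_of_mem_supp {C : M.coxeterGraph.ConnectedComponent} {n : ℕ}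
    (hn : 6 ≤ n) (hC : C.toSimpleGraph.IsContained (coxeterGraphE n)) :
    ∃ K, ∀ ω, IsClusterFactor cs h ω → (∀ i ∈ ω, i ∈ C.supp) → ω.length ≤ K := by
  obtain ⟨φ, hφ, hφn⟩ := exists_isLabelling hC
  obtain ⟨K, hK⟩ := IsNormalFactor.exists_length_le (cs := cs) (h := h) hφ (by omega : 3 ≤ n)
  refine ⟨K, fun ω hω hωC => ?_⟩
  obtain ⟨ω', e, hω'⟩ := hω.exists_isNormalFactor (φ := φ) hωC
  rw [e.length_eq]
  exact hK ω' hω' fun j hj => (hφn j (hω'.mem j hj)).le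

-- The letters of one component can be moved to the front of the word.
theorem count_le_of_length_le {C : M.coxeterGraph.ConnectedComponent} [DecidableEq B] {K : ℕ}
    (hK : ∀ ω, IsClusterFactor cs h ω → (∀ i ∈ ω, i ∈ C.supp) → ω.length ≤ K) {i : B}
    (hi : i ∈ C.supp) {ω : List B} (hω : IsClusterFactor cs h ω) : ω.count i ≤ K := by
  classical
  have hP : ∀ j k, decide (j ∈ C.supp) = false → decide (k ∈ C.supp) = true → M j k ≠ 3 := by
    intro j k hj hk hjk
    rw [decide_eq_false_iff_not] at hj
    rw [decide_eq_true_eq] at hk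
    exact hj ((C.mem_supp_congr_adj ⟨ne_of_eq_three hjk, hjk⟩).2 hk)
  have hfilter : IsClusterFactor cs h (ω.filter (· ∈ C.supp)) :=
    .factor (u := []) (by simpa using hω.of_wordEquiv (wordEquiv_filter cs h hP ω))
  calc ω.count i = (ω.filter (· ∈ C.supp)).count i :=
        (List.count_filter (by simpa using hi)).symm
    _ ≤ (ω.filter (· ∈ C.supp)).length := List.count_le_length
    _ ≤ K := hK _ hfilter fun j hj => by simpa using (List.mem_filter.1 hj).2

theorem finite_maximallyClustered [Finite B]
    (hE : ∀ C : M.coxeterGraph.ConnectedComponent,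
      ∃ n : ℕ, 6 ≤ n ∧ C.toSimpleGraph.IsContained (coxeterGraphE n)) :
    {w : W | cs.IsMaximallyClustered h w}.Finite := by
  classical
  choose n hn hC using hE
  choose K hK using fun C => exists_length_le_of_mem_supp cs h (hn C) (hC C)
  have := Fintype.ofFinite B
  refine ((List.finite_length_le B
    (∑ i, K (M.coxeterGraph.connectedComponentMk i))).image cs.wordProd).subset fun w hw => ?_
  obtain ⟨ω, hω, rfl⟩ := exists_isReducedExpr cs w
  have hfactor : IsClusterFactor cs h ω := ⟨[], [], by simpa using hω, by simpa using hw⟩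
  refine ⟨ω, ?_, rfl⟩
  calc ω.length = ∑ i, ω.count i := by
        simpa using (Multiset.sum_count_eq_card (s := Finset.univ) (m := (ω : Multiset B))
          fun _ _ => Finset.mem_univ _).symm
    _ ≤ ∑ i, K (M.coxeterGraph.connectedComponentMk i) :=
        Finset.sum_le_sum fun i _ => count_le_of_length_le cs h (hK _)
          SimpleGraph.ConnectedComponent.connectedComponentMk_mem hfactor

include h in
theorem finite_of_finite_fullyCommutative (hf : {w : W | cs.IsFullyCommutative w}.Finite) :
    Finite B := by
  by_contra hB
  rw [not_finite_iff_infinite] at hB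
  exact infinite_fullyCommutative_of_infinite cs h hf

include h in
theorem isContained_coxeterGraphE_of_finite_fullyCommutative
    (hf : {w : W | cs.IsFullyCommutative w}.Finite) (C : M.coxeterGraph.ConnectedComponent) :
    ∃ n : ℕ, 6 ≤ n ∧ C.toSimpleGraph.IsContained (coxeterGraphE n) := by
  have := finite_of_finite_fullyCommutative cs h hf
  refine exists_isContained_coxeterGraphE C.connected_toSimpleGraph fun hC => ?_
  exact infinite_fullyCommutative_of_hasInfinitePlay cs h
    (hC.of_isContained ⟨(SimpleGraph.Embedding.induce C.supp).toCopy⟩) hf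

end Equivalence

end SimplyLacedCoxeter

theorem theorem5p3 {B W : Type*} [Group W] {M : CoxeterMatrix B} (cs : CoxeterSystem M W)
    (h : M.IsSimplyLaced) :
    List.TFAE
      [{w : W | cs.IsMaximallyClustered h w}.Finite,
       {w : W | cs.IsFreelyBraided h w}.Finite,
       {w : W | cs.IsFullyCommutative w}.Finite] ∧
    (∀ w : W, cs.IsFullyCommutative w ↔ cs.IsIjiAvoiding w) ∧
    ({w : W | cs.IsMaximallyClustered h w}.Finite ↔
      Finite B ∧ ∀ C : M.coxeterGraph.ConnectedComponent,
        ∃ n : ℕ, 6 ≤ n ∧ C.toSimpleGraph.IsContained (coxeterGraphE n)) := by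
  have hiji := SimplyLacedCoxeter.isFullyCommutative_iff_isIjiAvoiding cs h
  have h12 (hf : {w : W | cs.IsMaximallyClustered h w}.Finite) :
      {w : W | cs.IsFreelyBraided h w}.Finite := hf.subset fun w hw => hw.1
  have h23 (hf : {w : W | cs.IsFreelyBraided h w}.Finite) :
      {w : W | cs.IsFullyCommutative w}.Finite :=
    hf.subset fun w hw => SimplyLacedCoxeter.isFreelyBraided_of_isIjiAvoiding cs h ((hiji w).1 hw)
  have h3E (hf : {w : W | cs.IsFullyCommutative w}.Finite) :=
    And.intro (SimplyLacedCoxeter.finite_of_finite_fullyCommutative cs h hf)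
      (SimplyLacedCoxeter.isContained_coxeterGraphE_of_finite_fullyCommutative cs h hf)
  have hE1 : (Finite B ∧ ∀ C : M.coxeterGraph.ConnectedComponent,
      ∃ n : ℕ, 6 ≤ n ∧ C.toSimpleGraph.IsContained (coxeterGraphE n)) →
      {w : W | cs.IsMaximallyClustered h w}.Finite :=
    fun ⟨_, hE⟩ => SimplyLacedCoxeter.finite_maximallyClustered cs h hE
  refine ⟨?_, hiji, fun hf => h3E (h23 (h12 hf)), hE1⟩
  tfae_have 1 → 2 := h12
  tfae_have 2 → 3 := h23
  tfae_have 3 → 1 := fun hf => hE1 (h3E hf)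
  tfae_finish
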